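/- Let $G$ and $H$ be locally compact (Hausdorff) groups with fixed left Haar measures. The Fourier algebra $A(G)$ is the space of functions $u(s)=\sum_n\langle\lambda(s)\xi_n,\eta_n\rangle$ with $\xi_n,\eta_n\in L^2(G)$ and $\sum_n\|\xi_n\|_2\|\eta_n\|_2<\infty$, where $\lambda$ is the left regular representation; its norm $\|u\|_A$ is the infimum of $\sum_n\|\xi_n\|_2\|\eta_n\|_2$ over all such representations. An ideal $\mathcal I$ of $A(G)$ has compact support if the closure of $\{t\in G: u(t)\neq 0\text{ for some }u\in\mathcal I\}$ is compact. Given a nonzero ideal $\mathcal I$ of $A(G)$ with compact support, Feichtinger's Segal algebra $S_0(G)$ is the range of the map $$q_{\mathcal I}:\ell^1(G)\,\widehat\otimes\,\mathcal I\to A(G),\qquad q_{\mathcal I}(x\otimes u)(t)=\sum_{s\in G}x(s)\,u(s^{-1}t),$$ where $\widehat\otimes$ is the operator projective tensor product and $\ell^1(G)$ has its maximal operator space structure; that is, $S_0(G)$ consists of all sums $\sum_n q_{\mathcal I}(x_n\otimes u_n)$ with $x_n\in\ell^1(G)$, $u_n\in\mathcal I$ and $\sum_n\|x_n\|_1\|u_n\|_A<\infty$.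 Define $S_0(H)$ in the same way, from any nonzero ideal of $A(H)$ with compact support. Write $u*v(x)=\int u(y)\,v(y^{-1}x)\,dy$ for the convolution with respect to the fixed left Haar measure. **Theorem.** Let $\Phi:S_0(G)\to S_0(H)$ be a bijection such that for all $u,v\in S_0(G)$ 1. $\Phi(u+\overline v)=\Phi(u)+\overline{\Phi(v)}$, 2. $\Phi(uv)=\Phi(u)\,\Phi(v)$ (pointwise products), 3. $\Phi(u*v)=\Phi(u)*\Phi(v)$. Then there are disjoint sets $H_1,H_2$ with $H=H_1\cup H_2$ and a map $\alpha:H\to G$ that is both a homeomorphism and a group isomorphism, such that $$\Phi u=\chi_{H_1}\,(u\circ\alpha)+\chi_{H_2}\,\overline{(u\circ\alpha)}\qquad\text{for every }u\in S_0(G).$$ -/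

import Mathlib

open MeasureTheory
open scoped ComplexConjugate

noncomputable section

namespace Feichtinger

variable {G : Type*} [Group G] [TopologicalSpace G] [MeasurableSpace G]

/-- The coefficient function `s ↦ ⟨λ(s) ξ, η⟩` of the left regular representation
`(λ(s) ξ)(t) = ξ (s⁻¹ t)` of `G` on `L²(G, μ)`. -/
def regularCoeff (μ : Measure G) (ξ η : Lp ℂ 2 μ) (s : G) : ℂ :=
  ∫ t, ξ (s⁻¹ * t) * conj (η t) ∂μ

/-- `u = ∑ₙ ⟨λ(·) ξₙ, ηₙ⟩` with `∑ₙ ‖ξₙ‖₂ ‖ηₙ‖₂ < ∞`. -/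
def IsFourierRepr (μ : Measure G) (u : G → ℂ) (ξ η : ℕ → Lp ℂ 2 μ) : Prop :=
  Summable (fun n => ‖ξ n‖ * ‖η n‖) ∧
    ∀ s, HasSum (fun n => regularCoeff μ (ξ n) (η n) s) (u s)

/-- The (underlying set of the) Fourier algebra `A(G)`, the coefficient space of the left regular
representation, i.e. the predual of the group von Neumann algebra realised as functions on `G`. -/
def fourierAlgebra (μ : Measure G) : Set (G → ℂ) :=
  {u | ∃ ξ η : ℕ → Lp ℂ 2 μ, IsFourierRepr μ u ξ η}

/-- The norm of `A(G)`: the infimum of `∑ₙ ‖ξₙ‖₂ ‖ηₙ‖₂` over all representations of `u`. -/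
def fourierNorm (μ : Measure G) (u : G → ℂ) : ℝ :=
  sInf {r | ∃ ξ η : ℕ → Lp ℂ 2 μ, IsFourierRepr μ u ξ η ∧ r = ∑' n, ‖ξ n‖ * ‖η n‖}

/-- `I` is a nonzero ideal of `A(G)` with compact support. The Gelfand spectrum of `A(G)` is `G`
(acting by point evaluations), so the support of `I` is the closure of the complement of the
hull `{t | ∀ u ∈ I, u t = 0}`. -/
structure IsCompactlySupportedIdeal (μ : Measure G) (I : Submodule ℂ (G → ℂ)) : Prop where
  subset_fourierAlgebra : ∀ u ∈ I, u ∈ fourierAlgebra μ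
  mul_mem : ∀ w ∈ fourierAlgebra μ, ∀ u ∈ I, w * u ∈ I
  ne_bot : I ≠ ⊥
  isCompact_support : IsCompact (closure {t : G | ∀ u ∈ I, u t = 0}ᶜ)

/-- `q (x ⊗ u) = ∑_{s ∈ G} x(s) s·u` for `x ∈ ℓ¹(G)`, where `(s·u)(t) = u (s⁻¹ t)`. -/
def tensorMap (x : lp (fun _ : G => ℂ) 1) (u : G → ℂ) (t : G) : ℂ :=
  ∑' s : G, x s * u (s⁻¹ * t)

/-- Feichtinger's Segal algebra `S₀(G)`, as the range of
`q : ℓ¹(G) ⊗̂ I → A(G)`, `q (x ⊗ u) = ∑ₛ x(s) s·u`, for a nonzero ideal `I` of `A(G)` with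
compact support. Since `ℓ¹(G)` carries its maximal operator space structure, the operator
projective tensor product `ℓ¹(G) ⊗̂ I` is, as a Banach space, the projective tensor product, so
its elements are exactly the series `∑ₙ xₙ ⊗ uₙ` with `xₙ ∈ ℓ¹(G)`, `uₙ ∈ I` and
`∑ₙ ‖xₙ‖₁ ‖uₙ‖_A < ∞`. Their images under `q` converge absolutely in `A(G)`, hence also uniformly
on `G` to the same sum. -/
def segalAlgebra (μ : Measure G) (I : Submodule ℂ (G → ℂ)) : Set (G → ℂ) :=
  {f | ∃ (x : ℕ → lp (fun _ : G => ℂ) 1) (u : ℕ → G → ℂ),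
    (∀ n, u n ∈ I) ∧ Summable (fun n => ‖x n‖ * fourierNorm μ (u n)) ∧
      ∀ t, HasSum (fun n => tensorMap (x n) (u n) t) (f t)}

/-- The convolution `(u ∗ v)(x) = ∫ u(y) v(y⁻¹ x) dy`. -/
def conv (μ : Measure G) (u v : G → ℂ) (x : G) : ℂ :=
  ∫ y, u y * v (y⁻¹ * x) ∂μ

end Feichtinger

end

/-!
A `*`-ring isomorphism `Φ` between two regular algebras of continuous functions that vanish at
infinity is composition with a homeomorphism `α`, followed at some points by complex conjugation
(`IsStarRingBij.exists_homeomorph`). Indeed, for a point `y` the functional `u ↦ Φ u y` cannot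
vanish on all functions of compact support (these are the `u` with `e u = u` for some `e`), and a
compactness argument shows that it depends only on the germ of `u` at one point `x = α y`. It kills
every `u` with `u x = 0`: after multiplication one would otherwise have `Φ u y = 1`, but the germ
of `u` at `x` agrees with that of an element `u'` with a quasi-inverse `r = u' + u' r`, and applying
the functional to this equation gives `0 = 1`. What remains is a ring endomorphism of `ℂ` that
commutes with conjugation, that is, the identity or the conjugation. The convolution enters only at
the end: for nonnegative `u` and `v` of small support, `u ∗ v` is nonzero exactly on
`{u ≠ 0} {v ≠ 0}`, which forces `α` to be multiplicative (`map_mul_of_conv`).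

The analytic part is that Feichtinger's algebra is regular in this sense
(`IsCompactlySupportedIdeal.isRegularAlgebra`). The Fourier algebra is made into a Banach space
`FourierAlg μ`, in which one can form Bochner integrals of coefficients. By the substitution of
Fell's absorption principle, a product of two coefficients `⟨λ(·) ξ, η⟩ ⟨λ(·) f, g⟩` is the integral
over `t` of the coefficients of the vectors `r ↦ ξ (r t) f (r)` and `r ↦ η (r t) g (r)`. This shows
that `A(G)` is a Banach algebra (`FourierAlg.mul_mem_fourierAlgebra`). If moreover `f` and `g` are
supported near `1`, then `ξ (r t) f (r)` is close to `ξ (t) f (r)`, so that the product is close to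
`⟨ξ, η⟩ ⟨λ(·) f, g⟩`. With bounded local units of this form one obtains synthesis at points
(`FourierAlg.exists_localUnit`): a function that vanishes at `x` agrees near `x` with elements of
arbitrarily small norm, and those are quasi-invertible by the Neumann series.

The same local inversion shows that translates of elements of the given ideal `I` generate functions
equal to `1` on any compact set. Hence Feichtinger's algebra consists of all sums `∑ₛ s·wₛ` with
`∑ₛ ‖wₛ‖ < ∞`, where the `wₛ` are arbitrary elements of `A(G)` supported in one compact set
(`IsCompactlySupportedIdeal.mem_segalAlgebra_iff`). In this form it is plainly closed under
conjugation and under multiplication by `A(G)`.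
-/

noncomputable section

namespace Feichtinger

open Filter Topology DomMulAct
open scoped Pointwise

set_option linter.unusedSectionVars false

variable {G : Type*} [Group G] [TopologicalSpace G] [IsTopologicalGroup G] [LocallyCompactSpace G]
  [T2Space G] [MeasurableSpace G] [BorelSpace G] {μ : Measure G} [μ.IsHaarMeasure] [μ.Regular]

/-! ### Coefficients of the regular representation -/

/-- In Mathlib's notation for the action of `G` on `L²(G)` through the domain, `λ(s) ξ` is
`DomMulAct.mk s⁻¹ • ξ`. -/
theorem regularCoeff_eq_inner (ξ η : Lp ℂ 2 μ) (s : G) :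
    regularCoeff μ ξ η s = inner ℂ η (DomMulAct.mk s⁻¹ • ξ) := by
  rw [L2.inner_def, regularCoeff]
  refine integral_congr_ae ?_
  filter_upwards [smul_Lp_ae_eq (DomMulAct.mk s⁻¹) ξ] with t ht
  rw [ht]
  simp

theorem norm_regularCoeff_le (ξ η : Lp ℂ 2 μ) (s : G) :
    ‖regularCoeff μ ξ η s‖ ≤ ‖ξ‖ * ‖η‖ := by
  rw [regularCoeff_eq_inner, mul_comm]
  refine (norm_inner_le_norm _ _).trans_eq ?_
  rw [norm_smul_Lp]

theorem continuous_regularCoeff (ξ η : Lp ℂ 2 μ) : Continuous (regularCoeff μ ξ η) := by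
  have : regularCoeff μ ξ η = fun s => inner ℂ η (DomMulAct.mk s⁻¹ • ξ) :=
    funext (regularCoeff_eq_inner ξ η)
  rw [this]
  have h : Continuous fun s : G => DomMulAct.mk s⁻¹ := by fun_prop
  have h2 : Fact ((2 : ENNReal) ≠ ⊤) := ⟨by simp⟩
  exact continuous_const.inner (h.smul continuous_const)

theorem regularCoeff_inv_mul (ξ η : Lp ℂ 2 μ) (s t : G) :
    regularCoeff μ ξ η (s⁻¹ * t) = regularCoeff μ ξ (DomMulAct.mk s⁻¹ • η) t := by
  rw [regularCoeff, regularCoeff]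
  rw [← integral_mul_left_eq_self _ s⁻¹]
  refine integral_congr_ae ?_
  filter_upwards [smul_Lp_ae_eq (DomMulAct.mk s⁻¹) η] with r hr
  rw [hr]
  simp [mul_assoc]

theorem conj_regularCoeff (ξ η : Lp ℂ 2 μ) (s : G) :
    conj (regularCoeff μ ξ η s) = regularCoeff μ (star ξ) (star η) s := by
  rw [regularCoeff, regularCoeff, ← integral_conj]
  refine integral_congr_ae ?_
  have h1 := (measurePreserving_mul_left μ s⁻¹).quasiMeasurePreserving.ae_eq_comp
    (Lp.coeFn_star ξ)
  filter_upwards [h1, Lp.coeFn_star η] with t ht ht'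
  simp only [Function.comp_apply, Pi.star_apply] at ht ht'
  rw [ht, ht']
  simp

theorem norm_star_Lp (ξ : Lp ℂ 2 μ) : ‖star ξ‖ = ‖ξ‖ := by
  refine congrArg ENNReal.toReal (eLpNorm_congr_norm_ae ?_)
  filter_upwards [Lp.coeFn_star ξ] with t ht
  rw [ht, Pi.star_apply, norm_star]

/-! ### The Fourier algebra as a Banach space -/

/-- A representation of `u` as an absolutely convergent series of coefficients, indexed by any
countable type, gives one indexed by `ℕ` with the same total. -/
theorem exists_isFourierRepr {ι : Type*} [Countable ι] {ξ η : ι → Lp ℂ 2 μ} {u : G → ℂ}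
    (hs : Summable fun i => ‖ξ i‖ * ‖η i‖)
    (hu : ∀ s, HasSum (fun i => regularCoeff μ (ξ i) (η i) s) (u s)) :
    ∃ ξ' η' : ℕ → Lp ℂ 2 μ, IsFourierRepr μ u ξ' η' ∧
      ∑' n, ‖ξ' n‖ * ‖η' n‖ = ∑' i, ‖ξ i‖ * ‖η i‖ := by
  obtain ⟨f, hf⟩ := exists_injective_nat ι
  have key : ∀ (F : Lp ℂ 2 μ → Lp ℂ 2 μ → ℂ), F 0 0 = 0 →
      (fun n => F (Function.extend f ξ 0 n) (Function.extend f η 0 n)) =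
        Function.extend f (fun i => F (ξ i) (η i)) 0 := by
    intro F h0
    funext n
    by_cases hn : ∃ i, f i = n
    · obtain ⟨i, rfl⟩ := hn
      simp [hf.extend_apply]
    · simp [Function.extend_apply' _ _ _ hn, h0]
  have key' : (fun n => ‖Function.extend f ξ 0 n‖ * ‖Function.extend f η 0 n‖) =
      Function.extend f (fun i => ‖ξ i‖ * ‖η i‖) 0 := by
    funext n
    by_cases hn : ∃ i, f i = n
    · obtain ⟨i, rfl⟩ := hn
      simp [hf.extend_apply]
    · simp [Function.extend_apply' _ _ _ hn]
  have h2 : HasSum (fun n => ‖Function.extend f ξ 0 n‖ * ‖Function.extend f η 0 n‖)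
      (∑' i, ‖ξ i‖ * ‖η i‖) := by
    rw [key', hasSum_extend_zero hf]
    exact hs.hasSum
  refine ⟨Function.extend f ξ 0, Function.extend f η 0, ⟨h2.summable, fun s => ?_⟩, h2.tsum_eq⟩
  rw [key (fun a b => regularCoeff μ a b s) (by simp [regularCoeff_eq_inner]),
    hasSum_extend_zero hf]
  exact hu s

theorem fourierNorm_nonneg (u : G → ℂ) : 0 ≤ fourierNorm μ u := by
  refine Real.sInf_nonneg ?_
  rintro r ⟨ξ, η, -, rfl⟩
  exact tsum_nonneg fun n => by positivity

/-- Any countably indexed representation bounds the norm of `A(G)`. -/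
theorem mem_fourierAlgebra_of_hasSum {ι : Type*} [Countable ι] {ξ η : ι → Lp ℂ 2 μ} {u : G → ℂ}
    (hs : Summable fun i => ‖ξ i‖ * ‖η i‖)
    (hu : ∀ s, HasSum (fun i => regularCoeff μ (ξ i) (η i) s) (u s)) :
    u ∈ fourierAlgebra μ ∧ fourierNorm μ u ≤ ∑' i, ‖ξ i‖ * ‖η i‖ := by
  obtain ⟨ξ', η', h, h'⟩ := exists_isFourierRepr hs hu
  refine ⟨⟨ξ', η', h⟩, csInf_le ⟨0, ?_⟩ ⟨ξ', η', h, h'.symm⟩⟩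
  rintro r ⟨ξ, η, -, rfl⟩
  exact tsum_nonneg fun n => by positivity

theorem exists_isFourierRepr_lt {u : G → ℂ} (hu : u ∈ fourierAlgebra μ) {C : ℝ}
    (hC : fourierNorm μ u < C) :
    ∃ ξ η : ℕ → Lp ℂ 2 μ, IsFourierRepr μ u ξ η ∧ ∑' n, ‖ξ n‖ * ‖η n‖ < C := by
  obtain ⟨ξ, η, h⟩ := hu
  obtain ⟨r, ⟨ξ, η, h, rfl⟩, hr⟩ := exists_lt_of_csInf_lt
    (s := {r | ∃ ξ η : ℕ → Lp ℂ 2 μ, IsFourierRepr μ u ξ η ∧ r = ∑' n, ‖ξ n‖ * ‖η n‖})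
    ⟨_, ξ, η, h, rfl⟩ hC
  exact ⟨ξ, η, h, hr⟩

theorem norm_apply_le_fourierNorm {u : G → ℂ} (hu : u ∈ fourierAlgebra μ) (s : G) :
    ‖u s‖ ≤ fourierNorm μ u := by
  refine le_of_forall_gt_imp_ge_of_dense fun C hC => ?_
  obtain ⟨ξ, η, h, hlt⟩ := exists_isFourierRepr_lt hu hC
  refine le_trans ?_ hlt.le
  rw [← (h.2 s).tsum_eq]
  exact tsum_of_norm_bounded h.1.hasSum fun n => norm_regularCoeff_le _ _ _

/-- The sum of an absolutely summable countable family in `A(G)` lies in `A(G)`, and its norm is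
at most the sum of the norms. -/
theorem hasSum_mem_fourierAlgebra {ι : Type*} [Countable ι] {u : ι → G → ℂ} {v : G → ℂ}
    (hu : ∀ i, u i ∈ fourierAlgebra μ) (hs : Summable fun i => fourierNorm μ (u i))
    (hv : ∀ s, HasSum (fun i => u i s) (v s)) :
    v ∈ fourierAlgebra μ ∧ fourierNorm μ v ≤ ∑' i, fourierNorm μ (u i) := by
  have main : ∀ ε > 0, v ∈ fourierAlgebra μ ∧
      fourierNorm μ v ≤ ∑' i, fourierNorm μ (u i) + ε := by
    intro ε hε
    obtain ⟨δ, hδ, c, hc, hcε⟩ := NNReal.exists_pos_sum_of_countable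
      (ε := ε.toNNReal) (by simpa using hε) ι
    choose ξ η h hlt using fun i => exists_isFourierRepr_lt (hu i)
      (lt_add_of_pos_right (fourierNorm μ (u i)) (NNReal.coe_pos.2 (hδ i)))
    have hδs : Summable fun i => (δ i : ℝ) := NNReal.summable_coe.2 hc.summable
    have hin : Summable fun i => ∑' n, ‖ξ i n‖ * ‖η i n‖ :=
      Summable.of_nonneg_of_le (fun i => tsum_nonneg fun n => by positivity)
        (fun i => (hlt i).le) (hs.add hδs)
    have hp : Summable fun p : ι × ℕ => ‖ξ p.1 p.2‖ * ‖η p.1 p.2‖ :=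
      (summable_prod_of_nonneg fun p => by positivity).2 ⟨fun i => (h i).1, hin⟩
    have hcoe : ∀ s, HasSum (fun p : ι × ℕ => regularCoeff μ (ξ p.1 p.2) (η p.1 p.2) s) (v s) := by
      intro s
      have hsm : Summable fun p : ι × ℕ => regularCoeff μ (ξ p.1 p.2) (η p.1 p.2) s :=
        Summable.of_norm_bounded hp fun p => norm_regularCoeff_le _ _ _
      have := hsm.hasSum.prod_fiberwise fun i => (h i).2 s
      rw [(hv s).unique this]
      exact hsm.hasSum
    obtain ⟨h1, h2⟩ := mem_fourierAlgebra_of_hasSum hp hcoe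
    refine ⟨h1, h2.trans ?_⟩
    rw [hp.tsum_prod' fun i => (h i).1]
    refine (hin.tsum_le_tsum (fun i => (hlt i).le) (hs.add hδs)).trans ?_
    rw [hs.tsum_add hδs]
    gcongr
    rw [← NNReal.coe_tsum, hc.tsum_eq]
    have := NNReal.coe_le_coe.2 hcε.le
    rwa [Real.coe_toNNReal _ hε.le] at this
  exact ⟨(main 1 one_pos).1, le_of_forall_pos_le_add fun ε hε => (main ε hε).2⟩

theorem regularCoeff_mem (ξ η : Lp ℂ 2 μ) :
    regularCoeff μ ξ η ∈ fourierAlgebra μ ∧ fourierNorm μ (regularCoeff μ ξ η) ≤ ‖ξ‖ * ‖η‖ := by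
  have := mem_fourierAlgebra_of_hasSum (ι := Unit) (ξ := fun _ => ξ) (η := fun _ => η)
    (u := regularCoeff μ ξ η) (Summable.of_finite)
    (fun s => by simp)
  simpa using this

theorem zero_mem_fourierAlgebra : (0 : G → ℂ) ∈ fourierAlgebra μ ∧ fourierNorm μ 0 = 0 := by
  have := mem_fourierAlgebra_of_hasSum (μ := μ) (ι := Empty) (ξ := fun i => i.elim)
    (η := fun i => i.elim) (u := (0 : G → ℂ)) (Summable.of_finite) (fun s => by simp)
  exact ⟨this.1, le_antisymm (by simpa using this.2) (fourierNorm_nonneg _)⟩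

theorem add_mem_fourierAlgebra {u v : G → ℂ} (hu : u ∈ fourierAlgebra μ)
    (hv : v ∈ fourierAlgebra μ) :
    u + v ∈ fourierAlgebra μ ∧ fourierNorm μ (u + v) ≤ fourierNorm μ u + fourierNorm μ v := by
  have := hasSum_mem_fourierAlgebra (μ := μ) (ι := Bool) (u := fun b => bif b then u else v)
    (v := u + v) (by rintro (_ | _) <;> assumption) Summable.of_finite
    (fun s => by
      have := hasSum_fintype (fun b : Bool => (bif b then u else v) s)
      simpa using this)
  simpa using this

/-- A map of `G → ℂ` that carries coefficients to coefficients without increasing norms preserves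
`A(G)` and does not increase its norm. -/
theorem map_mem_fourierAlgebra {T : (G → ℂ) → G → ℂ} {L R : Lp ℂ 2 μ → Lp ℂ 2 μ} {c : ℝ}
    (hc : 0 ≤ c) (hT : ∀ (ξ η : ℕ → Lp ℂ 2 μ) (u : G → ℂ),
      (∀ s, HasSum (fun n => regularCoeff μ (ξ n) (η n) s) (u s)) →
      ∀ s, HasSum (fun n => regularCoeff μ (L (ξ n)) (R (η n)) s) (T u s))
    (hL : ∀ ξ, ‖L ξ‖ = c * ‖ξ‖) (hR : ∀ ξ, ‖R ξ‖ = ‖ξ‖) {u : G → ℂ} (hu : u ∈ fourierAlgebra μ) :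
    T u ∈ fourierAlgebra μ ∧ fourierNorm μ (T u) ≤ c * fourierNorm μ u := by
  have main : ∀ C > fourierNorm μ u, T u ∈ fourierAlgebra μ ∧ fourierNorm μ (T u) ≤ c * C := by
    intro C hC
    obtain ⟨ξ, η, h, hlt⟩ := exists_isFourierRepr_lt hu hC
    have e : (fun n => ‖L (ξ n)‖ * ‖R (η n)‖) = fun n => c * (‖ξ n‖ * ‖η n‖) := by
      funext n
      rw [hL, hR, mul_assoc]
    have h1 := mem_fourierAlgebra_of_hasSum (ι := ℕ) (ξ := fun n => L (ξ n))
      (η := fun n => R (η n)) (u := T u) (by rw [e]; exact h.1.mul_left c) (hT _ _ _ h.2)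
    rw [e, tsum_mul_left] at h1
    exact ⟨h1.1, h1.2.trans (by gcongr)⟩
  refine ⟨(main _ (lt_add_one _)).1, ?_⟩
  refine le_of_forall_pos_le_add fun ε hε => ?_
  have hd : 0 < ε / (c + 1) := by positivity
  refine (main _ (lt_add_of_pos_right _ hd)).2.trans ?_
  rw [mul_add]
  gcongr
  rw [mul_div_assoc', div_le_iff₀ (by positivity)]
  nlinarith

theorem smul_mem_fourierAlgebra (c : ℂ) {u : G → ℂ} (hu : u ∈ fourierAlgebra μ) :
    c • u ∈ fourierAlgebra μ ∧ fourierNorm μ (c • u) ≤ ‖c‖ * fourierNorm μ u := by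
  refine map_mem_fourierAlgebra (T := fun u => c • u) (L := fun ξ => c • ξ) (R := id)
    (norm_nonneg c) (fun ξ η u h s => ?_) (fun ξ => norm_smul _ _) (fun ξ => rfl) hu
  have : ∀ n, regularCoeff μ (c • ξ n) (η n) s = c * regularCoeff μ (ξ n) (η n) s := by
    intro n
    rw [regularCoeff_eq_inner, regularCoeff_eq_inner, smul_comm, inner_smul_right]
  simpa [this] using (h s).mul_left c

theorem translate_mem_fourierAlgebra (s : G) {u : G → ℂ} (hu : u ∈ fourierAlgebra μ) :
    (fun t => u (s⁻¹ * t)) ∈ fourierAlgebra μ ∧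
      fourierNorm μ (fun t => u (s⁻¹ * t)) ≤ fourierNorm μ u := by
  have := map_mem_fourierAlgebra (T := fun u t => u (s⁻¹ * t)) (L := id)
    (R := fun η => DomMulAct.mk s⁻¹ • η) zero_le_one (fun ξ η u h t => ?_)
    (fun ξ => (one_mul _).symm) (fun ξ => norm_smul_Lp _ _) hu
  · rwa [one_mul] at this
  · simpa only [regularCoeff_inv_mul, id_eq] using h (s⁻¹ * t)

theorem star_mem_fourierAlgebra {u : G → ℂ} (hu : u ∈ fourierAlgebra μ) :
    star u ∈ fourierAlgebra μ ∧ fourierNorm μ (star u) ≤ fourierNorm μ u := by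
  have := map_mem_fourierAlgebra (T := fun u => star u) (L := star) (R := star)
    zero_le_one (fun ξ η u h t => ?_)
    (fun ξ => by rw [one_mul, norm_star_Lp]) norm_star_Lp hu
  · rwa [one_mul] at this
  · simp only [← conj_regularCoeff]
    exact (h t).star

/-- `A(G)` as a linear subspace of the space of all functions on `G`. -/
def fourierSubmodule (μ : Measure G) [μ.IsHaarMeasure] [μ.Regular] : Submodule ℂ (G → ℂ) where
  carrier := fourierAlgebra μ
  add_mem' hu hv := (add_mem_fourierAlgebra hu hv).1
  zero_mem' := zero_mem_fourierAlgebra.1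
  smul_mem' c _ hu := (smul_mem_fourierAlgebra c hu).1

/-- `A(G)` as a type of its own, so that it can carry the topology of the norm `fourierNorm`
instead of the topology of pointwise convergence. -/
def FourierAlg (μ : Measure G) [μ.IsHaarMeasure] [μ.Regular] : Type _ :=
  fourierSubmodule μ

namespace FourierAlg

instance : AddCommGroup (FourierAlg μ) := inferInstanceAs (AddCommGroup (fourierSubmodule μ))

instance : Module ℂ (FourierAlg μ) := inferInstanceAs (Module ℂ (fourierSubmodule μ))

instance : FunLike (FourierAlg μ) G ℂ where
  coe u := u.1
  coe_injective _ _ h := Subtype.ext h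

/-- The element of `A(G)` given by a function in the set `fourierAlgebra μ`. -/
def of (u : G → ℂ) (hu : u ∈ fourierAlgebra μ) : FourierAlg μ := ⟨u, hu⟩

@[simp] theorem coe_of (u : G → ℂ) (hu : u ∈ fourierAlgebra μ) : ⇑(of u hu) = u := rfl

theorem mem (u : FourierAlg μ) : ⇑u ∈ fourierAlgebra μ := u.2

@[ext] theorem ext {u v : FourierAlg μ} (h : ∀ t, u t = v t) : u = v := DFunLike.ext _ _ h

@[simp] theorem coe_zero : ⇑(0 : FourierAlg μ) = 0 := rfl

@[simp] theorem coe_add (u v : FourierAlg μ) : ⇑(u + v) = u + v := rfl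

@[simp] theorem coe_neg (u : FourierAlg μ) : ⇑(-u) = -u := rfl

@[simp] theorem coe_sub (u v : FourierAlg μ) : ⇑(u - v) = u - v := rfl

@[simp] theorem coe_smul (c : ℂ) (u : FourierAlg μ) : ⇑(c • u) = c • ⇑u := rfl

instance : NormedAddCommGroup (FourierAlg μ) :=
  AddGroupNorm.toNormedAddCommGroup
    { toFun := fun u => fourierNorm μ u
      map_zero' := zero_mem_fourierAlgebra.2
      add_le' := fun u v => (add_mem_fourierAlgebra u.mem v.mem).2
      neg' := by
        have h : ∀ u : FourierAlg μ, fourierNorm μ (-⇑u) ≤ fourierNorm μ u := fun u => by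
          simpa using (smul_mem_fourierAlgebra (-1) u.mem).2
        intro u
        refine le_antisymm (h u) ?_
        simpa using h (-u)
      eq_zero_of_map_eq_zero' := fun u hu => by
        ext t
        have := norm_apply_le_fourierNorm u.mem t
        rw [hu] at this
        simpa using this }

instance : NormedSpace ℂ (FourierAlg μ) where
  norm_smul_le c u := (smul_mem_fourierAlgebra c u.mem).2

theorem norm_apply_le (u : FourierAlg μ) (s : G) : ‖u s‖ ≤ ‖u‖ :=
  norm_apply_le_fourierNorm u.mem s

/-- Evaluation at a point, as a continuous functional on `A(G)`. -/
def evalCLM (s : G) : FourierAlg μ →L[ℂ] ℂ :=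
  LinearMap.mkContinuous
    { toFun := fun u => u s
      map_add' := fun _ _ => rfl
      map_smul' := fun _ _ => rfl } 1 fun u => by
      rw [one_mul]
      exact u.norm_apply_le s

@[simp] theorem evalCLM_apply (s : G) (u : FourierAlg μ) : evalCLM s u = u s := rfl

theorem exists_hasSum_of_summable (u : ℕ → FourierAlg μ) (hu : Summable fun n => ‖u n‖) :
    ∃ v : FourierAlg μ, ∀ s, HasSum (fun n => u n s) (v s) := by
  have h : ∀ s, HasSum (fun n => u n s) (∑' n, u n s) := fun s =>
    (Summable.of_norm_bounded hu fun n => (u n).norm_apply_le s).hasSum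
  exact ⟨of _ (hasSum_mem_fourierAlgebra (fun n => (u n).mem) hu h).1, h⟩

instance : CompleteSpace (FourierAlg μ) := by
  refine NormedAddCommGroup.completeSpace_of_summable_imp_tendsto fun u hu => ?_
  obtain ⟨v, hv⟩ := exists_hasSum_of_summable u hu
  refine ⟨v, tendsto_iff_norm_sub_tendsto_zero.2 ?_⟩
  -- the distance from the `n`-th partial sum is at most the tail of `∑ ‖u k‖`
  refine squeeze_zero (fun n => norm_nonneg _) (fun n => ?_)
    (tendsto_sum_nat_add fun n => ‖u n‖)
  rw [norm_sub_rev]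
  refine (hasSum_mem_fourierAlgebra (μ := μ) (u := fun k => ⇑(u (k + n)))
    (v := ⇑(v - ∑ i ∈ Finset.range n, u i)) (fun k => (u _).mem)
    ((summable_nat_add_iff n).2 hu) fun s => ?_).2
  have := (hasSum_nat_add_iff' n).2 (hv s)
  have e : (v - ∑ i ∈ Finset.range n, u i) s = v s - ∑ i ∈ Finset.range n, u i s := by
    simp only [coe_sub, Pi.sub_apply]
    congr 1
    exact map_sum (evalCLM s) u (Finset.range n)
  rw [e]
  exact this

/-- Left translation `(s·u)(t) = u (s⁻¹ t)` on `A(G)`. -/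
def translate (s : G) (u : FourierAlg μ) : FourierAlg μ :=
  of (fun t => u (s⁻¹ * t)) (translate_mem_fourierAlgebra s u.mem).1

@[simp] theorem translate_apply (s : G) (u : FourierAlg μ) (t : G) :
    translate s u t = u (s⁻¹ * t) := rfl

theorem norm_translate_le (s : G) (u : FourierAlg μ) : ‖translate s u‖ ≤ ‖u‖ :=
  (translate_mem_fourierAlgebra s u.mem).2

instance : Star (FourierAlg μ) := ⟨fun u => of (star ⇑u) (star_mem_fourierAlgebra u.mem).1⟩

@[simp] theorem coe_star (u : FourierAlg μ) : ⇑(star u) = star ⇑u := rfl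

theorem norm_star_le (u : FourierAlg μ) : ‖star u‖ ≤ ‖u‖ :=
  (star_mem_fourierAlgebra u.mem).2

/-- The coefficient `s ↦ ⟨λ(s) ξ, η⟩` as an element of `A(G)`. -/
def coeff (ξ η : Lp ℂ 2 μ) : FourierAlg μ := of (regularCoeff μ ξ η) (regularCoeff_mem ξ η).1

@[simp] theorem coe_coeff (ξ η : Lp ℂ 2 μ) : ⇑(coeff ξ η) = regularCoeff μ ξ η := rfl

theorem norm_coeff_le (ξ η : Lp ℂ 2 μ) : ‖coeff ξ η‖ ≤ ‖ξ‖ * ‖η‖ := (regularCoeff_mem ξ η).2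

theorem coeff_sub_left (ξ ξ' η : Lp ℂ 2 μ) : coeff (ξ - ξ') η = coeff ξ η - coeff ξ' η := by
  ext s
  simp [regularCoeff_eq_inner, smul_sub, inner_sub_right]

theorem coeff_sub_right (ξ η η' : Lp ℂ 2 μ) : coeff ξ (η - η') = coeff ξ η - coeff ξ η' := by
  ext s
  simp [regularCoeff_eq_inner, inner_sub_left]

theorem continuous_coeff : Continuous fun p : Lp ℂ 2 μ × Lp ℂ 2 μ => coeff p.1 p.2 := by
  rw [continuous_iff_continuousAt]
  rintro ⟨ξ, η⟩
  rw [ContinuousAt, tendsto_iff_norm_sub_tendsto_zero]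
  have hb : ∀ p : Lp ℂ 2 μ × Lp ℂ 2 μ, ‖coeff p.1 p.2 - coeff ξ η‖ ≤
      ‖p.1 - ξ‖ * ‖p.2‖ + ‖ξ‖ * ‖p.2 - η‖ := fun p => by
    have : coeff p.1 p.2 - coeff ξ η = coeff (p.1 - ξ) p.2 + coeff ξ (p.2 - η) := by
      rw [coeff_sub_left, coeff_sub_right]
      abel
    rw [this]
    exact (norm_add_le _ _).trans (add_le_add (norm_coeff_le _ _) (norm_coeff_le _ _))
  refine squeeze_zero (fun p => norm_nonneg _) hb ?_
  have : Continuous fun p : Lp ℂ 2 μ × Lp ℂ 2 μ => ‖p.1 - ξ‖ * ‖p.2‖ + ‖ξ‖ * ‖p.2 - η‖ := by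
    fun_prop
  simpa using this.tendsto (ξ, η)

/-- Every element of `A(G)` is an absolutely convergent series of coefficients. -/
theorem exists_coeff_hasSum (u : FourierAlg μ) {C : ℝ} (hC : ‖u‖ < C) :
    ∃ ξ η : ℕ → Lp ℂ 2 μ, Summable (fun n => ‖ξ n‖ * ‖η n‖) ∧
      HasSum (fun n => coeff (ξ n) (η n)) u ∧ ∑' n, ‖ξ n‖ * ‖η n‖ < C := by
  obtain ⟨ξ, η, h, hlt⟩ := exists_isFourierRepr_lt u.mem hC
  refine ⟨ξ, η, h.1, ?_, hlt⟩
  have hs : Summable fun n => coeff (ξ n) (η n) :=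
    Summable.of_norm_bounded h.1 fun n => norm_coeff_le _ _
  convert hs.hasSum
  ext s
  exact (h.2 s).unique (hs.hasSum.mapL (evalCLM s))

end FourierAlg

/-! ### Coefficients of compactly supported continuous functions -/

/-- The class in `L²(G)` of a compactly supported continuous function. -/
def toL2 (μ : Measure G) [μ.IsHaarMeasure] [μ.Regular] {f : G → ℂ} (hf : Continuous f)
    (hc : HasCompactSupport f) : Lp ℂ 2 μ :=
  (hf.memLp_of_hasCompactSupport hc).toLp f

theorem coeFn_toL2 {f : G → ℂ} (hf : Continuous f) (hc : HasCompactSupport f) :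
    toL2 μ hf hc =ᵐ[μ] f :=
  MemLp.coeFn_toLp _

theorem toL2_sub {f g : G → ℂ} (hf : Continuous f) (hfc : HasCompactSupport f)
    (hg : Continuous g) (hgc : HasCompactSupport g) :
    toL2 μ hf hfc - toL2 μ hg hgc = toL2 μ (hf.sub hg) (hfc.sub hgc) := rfl

theorem norm_toL2_sq {f : G → ℂ} (hf : Continuous f) (hc : HasCompactSupport f) :
    ‖toL2 μ hf hc‖ ^ 2 = ∫ t, ‖f t‖ ^ 2 ∂μ := by
  have h : (∫ t, inner ℂ (toL2 μ hf hc t) (toL2 μ hf hc t) ∂μ) = ((∫ t, ‖f t‖ ^ 2 ∂μ : ℝ) : ℂ) := by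
    rw [← integral_complex_ofReal]
    refine integral_congr_ae ?_
    filter_upwards [coeFn_toL2 (μ := μ) hf hc] with t ht
    rw [ht, inner_self_eq_norm_sq_to_K]
    simp
  rw [norm_sq_eq_re_inner (𝕜 := ℂ), L2.inner_def, h]
  simp

theorem regularCoeff_toL2 {f g : G → ℂ} (hf : Continuous f) (hfc : HasCompactSupport f)
    (hg : Continuous g) (hgc : HasCompactSupport g) (s : G) :
    regularCoeff μ (toL2 μ hf hfc) (toL2 μ hg hgc) s = ∫ t, f (s⁻¹ * t) * conj (g t) ∂μ := by
  refine integral_congr_ae ?_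
  have h1 := (measurePreserving_mul_left μ s⁻¹).quasiMeasurePreserving.ae_eq_comp
    (coeFn_toL2 (μ := μ) hf hfc)
  filter_upwards [h1, coeFn_toL2 (μ := μ) hg hgc] with t ht ht'
  simp only [Function.comp_apply] at ht
  rw [ht, ht']

theorem hasCompactSupport_slice {F : G × G → ℂ} (hFc : HasCompactSupport F) (t : G) :
    HasCompactSupport fun r => F (r, t) := by
  refine HasCompactSupport.intro (hFc.isCompact.image continuous_fst) fun r hr => ?_
  by_contra h
  exact hr ⟨(r, t), subset_tsupport _ h, rfl⟩

/-- The `L²` class of a slice `r ↦ F (r, t)` of a compactly supported continuous kernel. -/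
def sliceL2 (μ : Measure G) [μ.IsHaarMeasure] [μ.Regular] {F : G × G → ℂ} (hF : Continuous F)
    (hFc : HasCompactSupport F) (t : G) : Lp ℂ 2 μ :=
  toL2 μ (f := fun r => F (r, t)) (by fun_prop) (hasCompactSupport_slice hFc t)

theorem sliceL2_eq_zero {F : G × G → ℂ} (hF : Continuous F) (hFc : HasCompactSupport F) {t : G}
    (ht : t ∉ Prod.snd '' tsupport F) : sliceL2 μ hF hFc t = 0 := by
  have h : ∀ r, F (r, t) = 0 := fun r => by
    by_contra h
    exact ht ⟨(r, t), subset_tsupport _ h, rfl⟩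
  have := norm_toL2_sq (μ := μ) (f := fun r => F (r, t)) (by fun_prop)
    (hasCompactSupport_slice hFc t)
  simpa [h, sliceL2] using this

theorem continuous_sliceL2 {F : G × G → ℂ} (hF : Continuous F) (hFc : HasCompactSupport F) :
    Continuous (sliceL2 μ hF hFc) := by
  rw [continuous_iff_continuousAt]
  intro t₀
  have h1 : ∀ t, ‖sliceL2 μ hF hFc t - sliceL2 μ hF hFc t₀‖ ^ 2 =
      ∫ r, ‖F (r, t) - F (r, t₀)‖ ^ 2 ∂μ := fun t => by
    rw [sliceL2, sliceL2, toL2_sub, norm_toL2_sq]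
    rfl
  have h2 : ContinuousOn (fun t => ∫ r, ‖F (r, t) - F (r, t₀)‖ ^ 2 ∂μ) Set.univ := by
    refine continuousOn_integral_of_compact_support
      (hFc.isCompact.image continuous_fst) (by fun_prop) fun t r _ hr => ?_
    have h : ∀ t, F (r, t) = 0 := fun t => by
      by_contra h
      exact hr ⟨(r, t), subset_tsupport _ h, rfl⟩
    simp [h]
  have h3 := (continuousOn_univ.1 h2).tendsto t₀
  simp only [← h1] at h3
  rw [ContinuousAt, tendsto_iff_norm_sub_tendsto_zero]
  simpa using h3.sqrt

theorem memLp_norm_sliceL2 {F : G × G → ℂ} (hF : Continuous F)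
    (hFc : HasCompactSupport F) : MemLp (fun t => ‖sliceL2 μ hF hFc t‖) 2 μ := by
  refine Continuous.memLp_of_hasCompactSupport (continuous_sliceL2 hF hFc).norm ?_
  refine HasCompactSupport.intro (hFc.isCompact.image continuous_snd) fun t ht => ?_
  rw [sliceL2_eq_zero hF hFc ht, norm_zero]

theorem integrable_coeff_sliceL2 {F K : G × G → ℂ} (hF : Continuous F)
    (hFc : HasCompactSupport F) (hK : Continuous K) (hKc : HasCompactSupport K) :
    Integrable (fun t => FourierAlg.coeff (sliceL2 μ hF hFc t) (sliceL2 μ hK hKc t)) μ := by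
  refine Continuous.integrable_of_hasCompactSupport (FourierAlg.continuous_coeff.comp
    ((continuous_sliceL2 hF hFc).prodMk (continuous_sliceL2 hK hKc))) ?_
  refine HasCompactSupport.intro (hFc.isCompact.image continuous_snd) fun t ht => ?_
  simp only [sliceL2_eq_zero hF hFc ht]
  refine norm_le_zero_iff.1 ((FourierAlg.norm_coeff_le _ _).trans_eq ?_)
  simp

/-- A compactly supported continuous kernel `F` on `G × G`, regarded as an element of
`L²(G; L²(G))`, defines with another such kernel `K` the element
`∫ₜ ⟨λ(·) F(·, t), K(·, t)⟩ dt` of `A(G)`. The integral is a Bochner integral in the Banach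
space `A(G)`. -/
def kernelCoeff (μ : Measure G) [μ.IsHaarMeasure] [μ.Regular] {F K : G × G → ℂ}
    (hF : Continuous F) (hFc : HasCompactSupport F) (hK : Continuous K)
    (hKc : HasCompactSupport K) : FourierAlg μ :=
  ∫ t, FourierAlg.coeff (sliceL2 μ hF hFc t) (sliceL2 μ hK hKc t) ∂μ

theorem kernelCoeff_apply {F K : G × G → ℂ} (hF : Continuous F)
    (hFc : HasCompactSupport F) (hK : Continuous K) (hKc : HasCompactSupport K) (s : G) :
    kernelCoeff μ hF hFc hK hKc s = ∫ t, ∫ r, F (s⁻¹ * r, t) * conj (K (r, t)) ∂μ ∂μ := by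
  have := (FourierAlg.evalCLM (μ := μ) s).integral_comp_comm
    (integrable_coeff_sliceL2 hF hFc hK hKc)
  rw [FourierAlg.evalCLM_apply] at this
  rw [kernelCoeff, ← this]
  refine integral_congr_ae (ae_of_all _ fun t => ?_)
  exact regularCoeff_toL2 _ _ _ _ s

theorem norm_kernelCoeff_le {F K : G × G → ℂ} (hF : Continuous F)
    (hFc : HasCompactSupport F) (hK : Continuous K) (hKc : HasCompactSupport K) :
    ‖kernelCoeff μ hF hFc hK hKc‖ ≤
      √(∫ t, ∫ r, ‖F (r, t)‖ ^ 2 ∂μ ∂μ) * √(∫ t, ∫ r, ‖K (r, t)‖ ^ 2 ∂μ ∂μ) := by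
  refine (norm_integral_le_integral_norm _).trans ?_
  have h1 : ∫ t, ‖FourierAlg.coeff (sliceL2 μ hF hFc t) (sliceL2 μ hK hKc t)‖ ∂μ ≤
      ∫ t, ‖sliceL2 μ hF hFc t‖ * ‖sliceL2 μ hK hKc t‖ ∂μ :=
    integral_mono (integrable_coeff_sliceL2 hF hFc hK hKc).norm
      ((memLp_norm_sliceL2 hF hFc).integrable_mul (memLp_norm_sliceL2 hK hKc))
      fun t => FourierAlg.norm_coeff_le _ _
  refine h1.trans ?_
  have h2 := integral_mul_le_Lp_mul_Lq_of_nonneg (μ := μ) Real.HolderConjugate.two_two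
    (f := fun t => ‖sliceL2 μ hF hFc t‖) (g := fun t => ‖sliceL2 μ hK hKc t‖)
    (ae_of_all _ fun t => norm_nonneg _) (ae_of_all _ fun t => norm_nonneg _)
    (by simpa using memLp_norm_sliceL2 hF hFc)
    (by simpa using memLp_norm_sliceL2 hK hKc)
  simpa [Real.sqrt_eq_rpow, sliceL2, norm_toL2_sq] using h2

theorem kernelCoeff_sub_left {F F' K : G × G → ℂ} (hF : Continuous F)
    (hFc : HasCompactSupport F) (hF' : Continuous F') (hFc' : HasCompactSupport F')
    (hK : Continuous K) (hKc : HasCompactSupport K) :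
    kernelCoeff μ (hF.sub hF') (hFc.sub hFc') hK hKc =
      kernelCoeff μ hF hFc hK hKc - kernelCoeff μ hF' hFc' hK hKc := by
  rw [kernelCoeff, kernelCoeff, kernelCoeff, ← integral_sub (integrable_coeff_sliceL2 (μ := μ) hF hFc hK hKc)
    (integrable_coeff_sliceL2 hF' hFc' hK hKc)]
  refine integral_congr_ae (ae_of_all _ fun t => ?_)
  exact FourierAlg.coeff_sub_left (sliceL2 μ hF hFc t) (sliceL2 μ hF' hFc' t) (sliceL2 μ hK hKc t)

theorem kernelCoeff_sub_right {F K K' : G × G → ℂ} (hF : Continuous F)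
    (hFc : HasCompactSupport F) (hK : Continuous K) (hKc : HasCompactSupport K)
    (hK' : Continuous K') (hKc' : HasCompactSupport K') :
    kernelCoeff μ hF hFc (hK.sub hK') (hKc.sub hKc') =
      kernelCoeff μ hF hFc hK hKc - kernelCoeff μ hF hFc hK' hKc' := by
  rw [kernelCoeff, kernelCoeff, kernelCoeff, ← integral_sub (integrable_coeff_sliceL2 (μ := μ) hF hFc hK hKc)
    (integrable_coeff_sliceL2 hF hFc hK' hKc')]
  refine integral_congr_ae (ae_of_all _ fun t => ?_)
  exact FourierAlg.coeff_sub_right (sliceL2 μ hF hFc t) (sliceL2 μ hK hKc t) (sliceL2 μ hK' hKc' t)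

/-! ### Products of coefficients -/

theorem hasCompactSupport_twist {𝕜 : Type*} [MulZeroClass 𝕜] {φ ψ : G → 𝕜}
    (hφ : HasCompactSupport φ) (hψ : HasCompactSupport ψ) :
    HasCompactSupport fun p : G × G => φ (p.1 * p.2) * ψ p.1 := by
  refine HasCompactSupport.intro
    (hψ.isCompact.prod (hψ.isCompact.inv.mul hφ.isCompact)) fun p hp => ?_
  by_contra h
  have h1 : p.1 * p.2 ∈ tsupport φ := subset_tsupport _ (left_ne_zero_of_mul h)
  have h2 : p.1 ∈ tsupport ψ := subset_tsupport _ (right_ne_zero_of_mul h)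
  exact hp ⟨h2, p.1⁻¹, Set.inv_mem_inv.2 h2, p.1 * p.2, h1, by simp⟩

theorem hasCompactSupport_tensor {𝕜 : Type*} [MulZeroClass 𝕜] {φ ψ : G → 𝕜}
    (hφ : HasCompactSupport φ) (hψ : HasCompactSupport ψ) :
    HasCompactSupport fun p : G × G => φ p.2 * ψ p.1 := by
  refine HasCompactSupport.intro (hψ.isCompact.prod hφ.isCompact) fun p hp => ?_
  by_contra h
  exact hp ⟨subset_tsupport _ (right_ne_zero_of_mul h), subset_tsupport _ (left_ne_zero_of_mul h)⟩

/-- Left invariance separates the variables of the twisted tensor product `φ (r t) ψ (r)`. -/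
theorem integral_integral_twist {𝕜 : Type*} [RCLike 𝕜] {φ ψ : G → 𝕜} (hφ : Continuous φ)
    (hφc : HasCompactSupport φ) (hψ : Continuous ψ) (hψc : HasCompactSupport ψ) :
    ∫ t, ∫ r, φ (r * t) * ψ r ∂μ ∂μ = (∫ t, φ t ∂μ) * ∫ r, ψ r ∂μ := by
  rw [← integral_integral_swap_of_hasCompactSupport (f := fun r t => φ (r * t) * ψ r)
    (by unfold Function.uncurry; fun_prop) (hasCompactSupport_twist hφc hψc)]
  rw [← integral_const_mul]
  refine integral_congr_ae (ae_of_all _ fun r => ?_)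
  simp only
  rw [integral_mul_const, integral_mul_left_eq_self φ r]

theorem sqrt_integral_twist {φ ψ : G → ℂ} (hφ : Continuous φ)
    (hφc : HasCompactSupport φ) (hψ : Continuous ψ) (hψc : HasCompactSupport ψ) :
    √(∫ t, ∫ r, ‖φ (r * t) * ψ r‖ ^ 2 ∂μ ∂μ) = ‖toL2 μ hφ hφc‖ * ‖toL2 μ hψ hψc‖ := by
  rw [← Real.sqrt_sq (by positivity : 0 ≤ ‖toL2 μ hφ hφc‖ * ‖toL2 μ hψ hψc‖), mul_pow,
    norm_toL2_sq, norm_toL2_sq]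
  simp only [norm_mul, mul_pow]
  rw [integral_integral_twist (φ := fun t => ‖φ t‖ ^ 2) (ψ := fun t => ‖ψ t‖ ^ 2) (by fun_prop)
    (hφc.comp_left (g := fun z => ‖z‖ ^ 2) (by simp)) (by fun_prop)
    (hψc.comp_left (g := fun z => ‖z‖ ^ 2) (by simp))]

theorem sqrt_integral_tensor {φ ψ : G → ℂ} (hφ : Continuous φ)
    (hφc : HasCompactSupport φ) (hψ : Continuous ψ) (hψc : HasCompactSupport ψ) :
    √(∫ t, ∫ r, ‖φ t * ψ r‖ ^ 2 ∂μ ∂μ) = ‖toL2 μ hφ hφc‖ * ‖toL2 μ hψ hψc‖ := by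
  rw [← Real.sqrt_sq (by positivity : 0 ≤ ‖toL2 μ hφ hφc‖ * ‖toL2 μ hψ hψc‖), mul_pow,
    norm_toL2_sq, norm_toL2_sq]
  simp only [norm_mul, mul_pow, integral_const_mul, integral_mul_const]

variable {ξ η f g : G → ℂ}

/-- Fell's absorption principle for coefficients: after the substitution `t ↦ r t`, the product
of two coefficients is the coefficient of the kernels `ξ (r t) f (r)` and `η (r t) g (r)`. -/
theorem kernelCoeff_twist_apply (hξ : Continuous ξ) (hξc : HasCompactSupport ξ)
    (hη : Continuous η) (hηc : HasCompactSupport η) (hf : Continuous f)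
    (hfc : HasCompactSupport f) (hg : Continuous g) (hgc : HasCompactSupport g) (s : G) :
    kernelCoeff μ (F := fun p => ξ (p.1 * p.2) * f p.1) (K := fun p => η (p.1 * p.2) * g p.1)
      (by fun_prop) (hasCompactSupport_twist hξc hfc) (by fun_prop)
      (hasCompactSupport_twist hηc hgc) s =
    regularCoeff μ (toL2 μ hξ hξc) (toL2 μ hη hηc) s *
      regularCoeff μ (toL2 μ hf hfc) (toL2 μ hg hgc) s := by
  rw [kernelCoeff_apply, regularCoeff_toL2, regularCoeff_toL2]
  rw [← integral_integral_twist (φ := fun t => ξ (s⁻¹ * t) * conj (η t))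
    (ψ := fun t => f (s⁻¹ * t) * conj (g t))
    ((hξ.comp (continuous_const_mul _)).mul (Complex.continuous_conj.comp hη))
    ((hηc.comp_left (g := fun z => conj z) (by simp)).mul_left)
    ((hf.comp (continuous_const_mul _)).mul (Complex.continuous_conj.comp hg))
    ((hgc.comp_left (g := fun z => conj z) (by simp)).mul_left)]
  congr! 4 with t r
  simp only [map_mul, mul_assoc]
  ring

theorem kernelCoeff_tensor_apply (hξ : Continuous ξ) (hξc : HasCompactSupport ξ)
    (hη : Continuous η) (hηc : HasCompactSupport η) (hf : Continuous f)
    (hfc : HasCompactSupport f) (hg : Continuous g) (hgc : HasCompactSupport g) (s : G) :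
    kernelCoeff μ (F := fun p => ξ p.2 * f p.1) (K := fun p => η p.2 * g p.1)
      (by fun_prop) (hasCompactSupport_tensor hξc hfc) (by fun_prop)
      (hasCompactSupport_tensor hηc hgc) s =
    regularCoeff μ (toL2 μ hξ hξc) (toL2 μ hη hηc) 1 *
      regularCoeff μ (toL2 μ hf hfc) (toL2 μ hg hgc) s := by
  rw [kernelCoeff_apply, regularCoeff_toL2, regularCoeff_toL2, ← integral_mul_const]
  congr! 2 with t
  rw [← integral_const_mul]
  congr! 2 with r
  simp only [map_mul, inv_one, one_mul]
  ring

/-- Translating a function little in `L²` over the support of `f` moves the twisted tensor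
product little away from the tensor product. -/
theorem sqrt_integral_twist_sub_tensor_le (hξ : Continuous ξ) (hξc : HasCompactSupport ξ)
    (hf : Continuous f) (hfc : HasCompactSupport f) {δ : ℝ} (hδ : 0 ≤ δ)
    (h : ∀ r, f r ≠ 0 → ‖DomMulAct.mk r • toL2 μ hξ hξc - toL2 μ hξ hξc‖ ≤ δ) :
    √(∫ t, ∫ r, ‖ξ (r * t) * f r - ξ t * f r‖ ^ 2 ∂μ ∂μ) ≤ δ * ‖toL2 μ hf hfc‖ := by
  rw [← Real.sqrt_sq (by positivity : 0 ≤ δ * ‖toL2 μ hf hfc‖)]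
  refine Real.sqrt_le_sqrt ?_
  have hsupp : HasCompactSupport fun p : G × G => ‖ξ (p.1 * p.2) * f p.1 - ξ p.2 * f p.1‖ ^ 2 :=
    ((hasCompactSupport_twist hξc hfc).sub (hasCompactSupport_tensor hξc hfc)).comp_left
      (g := fun z => ‖z‖ ^ 2) (by simp)
  have hcont : Continuous fun p : G × G => ‖ξ (p.1 * p.2) * f p.1 - ξ p.2 * f p.1‖ ^ 2 := by
    fun_prop
  rw [← integral_integral_swap_of_hasCompactSupport
    (f := fun r t => ‖ξ (r * t) * f r - ξ t * f r‖ ^ 2) hcont hsupp]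
  have hin : ∀ r, ∫ t, ‖ξ (r * t) * f r - ξ t * f r‖ ^ 2 ∂μ ≤ δ ^ 2 * ‖f r‖ ^ 2 := by
    intro r
    by_cases hr : f r = 0
    · simp [hr]
    have hc' : Continuous fun t => ξ (r * t) := by fun_prop
    have hcc : HasCompactSupport fun t => ξ (r * t) :=
      hξc.comp_homeomorph (Homeomorph.mulLeft r)
    have e : DomMulAct.mk r • toL2 μ hξ hξc = toL2 μ hc' hcc := rfl
    have h1 := h r hr
    rw [e, toL2_sub] at h1
    have h2 := pow_le_pow_left₀ (norm_nonneg _) h1 2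
    rw [norm_toL2_sq] at h2
    simp only [← sub_mul, norm_mul, mul_pow, integral_mul_const]
    gcongr
    exact h2
  rw [mul_pow, norm_toL2_sq, ← integral_const_mul]
  refine integral_mono_of_nonneg (ae_of_all _ fun r => integral_nonneg fun t => by positivity)
    ?_ (ae_of_all _ hin)
  refine Continuous.integrable_of_hasCompactSupport (by fun_prop) ?_
  exact hfc.comp_left (g := fun z => δ ^ 2 * ‖z‖ ^ 2) (by simp)

namespace FourierAlg

/-- The coefficient of two compactly supported continuous functions. -/
def coeffC (μ : Measure G) [μ.IsHaarMeasure] [μ.Regular] (hf : Continuous f)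
    (hfc : HasCompactSupport f) (hg : Continuous g) (hgc : HasCompactSupport g) : FourierAlg μ :=
  coeff (toL2 μ hf hfc) (toL2 μ hg hgc)

theorem coeffC_apply (hf : Continuous f)
    (hfc : HasCompactSupport f) (hg : Continuous g) (hgc : HasCompactSupport g) (s : G) :
    coeffC μ hf hfc hg hgc s = ∫ t, f (s⁻¹ * t) * conj (g t) ∂μ :=
  regularCoeff_toL2 hf hfc hg hgc s

theorem exists_coeffC_mul (hξ : Continuous ξ) (hξc : HasCompactSupport ξ)
    (hη : Continuous η) (hηc : HasCompactSupport η) (hf : Continuous f)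
    (hfc : HasCompactSupport f) (hg : Continuous g) (hgc : HasCompactSupport g) :
    ∃ w : FourierAlg μ, (⇑w = coeffC μ hξ hξc hη hηc * coeffC μ hf hfc hg hgc) ∧
      ‖w‖ ≤ (‖toL2 μ hξ hξc‖ * ‖toL2 μ hη hηc‖) * (‖toL2 μ hf hfc‖ * ‖toL2 μ hg hgc‖) := by
  refine ⟨kernelCoeff μ (F := fun p => ξ (p.1 * p.2) * f p.1)
    (K := fun p => η (p.1 * p.2) * g p.1) (by fun_prop) (hasCompactSupport_twist hξc hfc)
    (by fun_prop) (hasCompactSupport_twist hηc hgc),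
    funext (kernelCoeff_twist_apply hξ hξc hη hηc hf hfc hg hgc), ?_⟩
  refine (norm_kernelCoeff_le _ _ _ _).trans_eq ?_
  rw [sqrt_integral_twist hξ hξc hf hfc, sqrt_integral_twist hη hηc hg hgc]
  ring

/-- If the supports of `f` and `g` are so small that translation by their elements hardly moves
`ξ` and `η`, then `⟨λ(·) ξ, η⟩` acts on `⟨λ(·) f, g⟩` nearly as multiplication by its value at
`1`. -/
theorem exists_coeffC_mul_sub (hξ : Continuous ξ) (hξc : HasCompactSupport ξ)
    (hη : Continuous η) (hηc : HasCompactSupport η) (hf : Continuous f)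
    (hfc : HasCompactSupport f) (hg : Continuous g) (hgc : HasCompactSupport g) {δ : ℝ}
    (hδ : 0 ≤ δ) (h1 : ∀ r, f r ≠ 0 → ‖DomMulAct.mk r • toL2 μ hξ hξc - toL2 μ hξ hξc‖ ≤ δ)
    (h2 : ∀ r, g r ≠ 0 → ‖DomMulAct.mk r • toL2 μ hη hηc - toL2 μ hη hηc‖ ≤ δ) :
    ∃ w : FourierAlg μ, (⇑w = coeffC μ hξ hξc hη hηc * coeffC μ hf hfc hg hgc -
        coeffC μ hξ hξc hη hηc 1 • ⇑(coeffC μ hf hfc hg hgc)) ∧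
      ‖w‖ ≤ δ * (‖toL2 μ hξ hξc‖ + ‖toL2 μ hη hηc‖) * (‖toL2 μ hf hfc‖ * ‖toL2 μ hg hgc‖) := by
  have hF : Continuous fun p : G × G => ξ (p.1 * p.2) * f p.1 := by fun_prop
  have hFc := hasCompactSupport_twist hξc hfc
  have hF' : Continuous fun p : G × G => ξ p.2 * f p.1 := by fun_prop
  have hFc' := hasCompactSupport_tensor hξc hfc
  have hK : Continuous fun p : G × G => η (p.1 * p.2) * g p.1 := by fun_prop
  have hKc := hasCompactSupport_twist hηc hgc
  have hK' : Continuous fun p : G × G => η p.2 * g p.1 := by fun_prop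
  have hKc' := hasCompactSupport_tensor hηc hgc
  refine ⟨kernelCoeff μ (hF.sub hF') (hFc.sub hFc') hK hKc +
    kernelCoeff μ hF' hFc' (hK.sub hK') (hKc.sub hKc'), ?_, ?_⟩
  · rw [kernelCoeff_sub_left hF hFc hF' hFc', kernelCoeff_sub_right _ _ hK hKc hK' hKc']
    funext s
    simp only [coe_add, coe_sub, Pi.add_apply, Pi.sub_apply, Pi.mul_apply, Pi.smul_apply,
      smul_eq_mul]
    rw [kernelCoeff_twist_apply hξ hξc hη hηc hf hfc hg hgc,
      kernelCoeff_tensor_apply hξ hξc hη hηc hf hfc hg hgc]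
    simp only [coeffC, coe_coeff]
    ring
  · refine (norm_add_le _ _).trans ((add_le_add (norm_kernelCoeff_le _ _ _ _)
      (norm_kernelCoeff_le _ _ _ _)).trans ?_)
    rw [sqrt_integral_twist hη hηc hg hgc, sqrt_integral_tensor hξ hξc hf hfc]
    have e1 := sqrt_integral_twist_sub_tensor_le hξ hξc hf hfc hδ h1
    have e2 := sqrt_integral_twist_sub_tensor_le hη hηc hg hgc hδ h2
    calc _ ≤ (δ * ‖toL2 μ hf hfc‖) * (‖toL2 μ hη hηc‖ * ‖toL2 μ hg hgc‖) +
        (‖toL2 μ hξ hξc‖ * ‖toL2 μ hf hfc‖) * (δ * ‖toL2 μ hg hgc‖) := by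
          refine add_le_add (mul_le_mul_of_nonneg_right e1 (by positivity))
            (mul_le_mul_of_nonneg_left e2 (by positivity))
      _ = _ := by ring

end FourierAlg

/-! ### The Fourier algebra is a Banach algebra -/

/-- Compactly supported continuous functions are dense in `L²(G)`. (A locally compact space need
not be normal, so this uses Urysohn's lemma for compact sets.) -/
theorem exists_norm_sub_toL2_lt (ξ : Lp ℂ 2 μ) {ε : ℝ} (hε : 0 < ε) :
    ∃ (f : G → ℂ) (hf : Continuous f) (hfc : HasCompactSupport f), ‖ξ - toL2 μ hf hfc‖ < ε := by
  have hε' : ENNReal.ofReal (ε / 2) ≠ 0 := by simpa using hε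
  have hind : ∀ (c : ℂ) ⦃t : Set G⦄, MeasurableSet t → μ t < ⊤ → ∀ {ε : ENNReal}, ε ≠ 0 →
      ∃ g : G → ℂ, eLpNorm (g - t.indicator fun _ => c) 2 μ ≤ ε ∧
        (Continuous g ∧ HasCompactSupport g) := by
    intro c t ht htμ ε hε
    obtain ⟨η, hη, hηε⟩ := exists_eLpNorm_indicator_le (μ := μ) (p := 2) (by simp) c hε
    have hη2 : (η : ENNReal) / 2 ≠ 0 := by simpa using hη.ne'
    obtain ⟨K, hKt, hK, hKμ⟩ := ht.exists_isCompact_sdiff_lt htμ.ne hη2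
    obtain ⟨U, htU, hU, -, hUμ⟩ := ht.exists_isOpen_sdiff_lt htμ.ne hη2
    obtain ⟨f, hf1, hf0, hfc, hf01⟩ := exists_continuous_one_zero_of_isCompact hK
      hU.isClosed_compl (Set.disjoint_compl_right_iff_subset.2 (hKt.trans htU))
    refine ⟨fun x => f x • c, ?_, by fun_prop, hfc.smul_right⟩
    have hUK : μ (U \ K) ≤ η := by
      have hsub : U \ K ⊆ (U \ t) ∪ (t \ K) := fun x hx => by
        by_cases hxt : x ∈ t
        · exact Or.inr ⟨hxt, hx.2⟩
        · exact Or.inl ⟨hx.1, hxt⟩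
      refine (measure_mono hsub).trans ((measure_union_le _ _).trans ?_)
      rw [← ENNReal.add_halves (η : ENNReal)]
      exact add_le_add hUμ.le hKμ.le
    refine (eLpNorm_mono fun x => ?_).trans (hηε (U \ K) hUK)
    have h01 := hf01 x
    by_cases hxK : x ∈ K
    · simp [hf1 hxK, hKt hxK, hxK]
    by_cases hxU : x ∈ U
    · rw [Set.indicator_of_mem (show x ∈ U \ K from ⟨hxU, hxK⟩), Pi.sub_apply]
      have : f x • c - t.indicator (fun _ => c) x =
          (f x - t.indicator (fun _ => (1 : ℝ)) x) • c := by
        by_cases hxt : x ∈ t <;> simp [hxt, sub_smul]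
      rw [this, norm_smul]
      refine mul_le_of_le_one_left (norm_nonneg _) ?_
      rw [Real.norm_eq_abs, abs_le]
      by_cases hxt : x ∈ t <;> simp [hxt] <;> constructor <;> linarith [h01.1, h01.2]
    · have hxt : x ∉ t := fun h => hxU (htU h)
      simp [hf0 hxU, hxt, hxU]
  obtain ⟨f, hle, hf, hfc⟩ := (Lp.memLp ξ).induction_dense (by simp)
    (fun f : G → ℂ => Continuous f ∧ HasCompactSupport f) hind
    (fun f g hf hg => ⟨hf.1.add hg.1, hf.2.add hg.2⟩)
    (fun f hf => (hf.1.memLp_of_hasCompactSupport (p := 2) hf.2).aestronglyMeasurable) hε'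
  refine ⟨f, hf, hfc, ?_⟩
  have h : eLpNorm (⇑(ξ - toL2 μ hf hfc)) 2 μ = eLpNorm (⇑ξ - f) 2 μ := by
    refine eLpNorm_congr_ae ?_
    filter_upwards [Lp.coeFn_sub ξ (toL2 μ hf hfc), coeFn_toL2 (μ := μ) hf hfc] with t h1 h2
    rw [h1, Pi.sub_apply, Pi.sub_apply, h2]
  rw [Lp.norm_def, h]
  refine (ENNReal.toReal_le_of_le_ofReal (by positivity) hle).trans_lt (by linarith)

/-- The classes of compactly supported continuous functions in `L²(G)`. -/
def ccSubgroup (μ : Measure G) [μ.IsHaarMeasure] [μ.Regular] : AddSubgroup (Lp ℂ 2 μ) where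
  carrier := {x | ∃ (f : G → ℂ) (hf : Continuous f) (hfc : HasCompactSupport f),
    toL2 μ hf hfc = x}
  add_mem' := by
    rintro _ _ ⟨f, hf, hfc, rfl⟩ ⟨g, hg, hgc, rfl⟩
    exact ⟨_, hf.add hg, hfc.add hgc, rfl⟩
  zero_mem' := ⟨0, continuous_zero, HasCompactSupport.zero, rfl⟩
  neg_mem' := by
    rintro _ ⟨f, hf, hfc, rfl⟩
    exact ⟨_, hf.neg, hfc.neg, rfl⟩

theorem mem_closure_ccSubgroup (ξ : Lp ℂ 2 μ) : ξ ∈ closure (ccSubgroup μ : Set (Lp ℂ 2 μ)) := by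
  refine Metric.mem_closure_iff.2 fun ε hε => ?_
  obtain ⟨f, hf, hfc, h⟩ := exists_norm_sub_toL2_lt ξ hε
  exact ⟨_, ⟨f, hf, hfc, rfl⟩, by rwa [dist_eq_norm]⟩

/-- A vector of `L²(G)` is the sum of an absolutely convergent series of compactly supported
continuous functions, with hardly any loss in the sum of the norms. -/
theorem exists_ccSubgroup_hasSum (ξ : Lp ℂ 2 μ) {δ : ℝ} (hδ : 0 < δ) :
    ∃ x : ℕ → Lp ℂ 2 μ, (∀ n, x n ∈ ccSubgroup μ) ∧ HasSum x ξ ∧ Summable (fun n => ‖x n‖) ∧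
      ∑' n, ‖x n‖ ≤ (1 + δ) * ‖ξ‖ := by
  rcases eq_or_ne ξ 0 with rfl | hξ
  · exact ⟨0, fun n => zero_mem _, hasSum_zero, by simp, by simp⟩
  have hpos : 0 < δ * ‖ξ‖ := mul_pos hδ (norm_pos_iff.2 hξ)
  set b : ℕ → ℝ := fun n => δ * ‖ξ‖ / 2 / 2 ^ n with hb
  have hbs : HasSum b (δ * ‖ξ‖) := hasSum_geometric_two' _
  obtain ⟨x, hx, hmem, h0, hn⟩ := controlled_sum_of_mem_closure (mem_closure_ccSubgroup ξ)
    (b := b) (fun n => by positivity)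
  -- the first term is close to `ξ`, the others sum to less than `δ ‖ξ‖`
  have hle : ∀ n, ‖x n‖ ≤ b n + if n = 0 then ‖ξ‖ else 0 := by
    intro n
    rcases Nat.eq_zero_or_pos n with rfl | hpos
    · have := norm_le_norm_add_norm_sub' (x 0) ξ
      simp only [if_true]
      have h0' : ‖x 0 - ξ‖ < b 0 := by rwa [← norm_neg, neg_sub, sub_eq_neg_add]
      linarith
    · simpa [hpos.ne'] using (hn n hpos).le
  have hmaj := hbs.add (hasSum_ite_eq 0 ‖ξ‖)
  have hsum : Summable fun n => ‖x n‖ :=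
    Summable.of_nonneg_of_le (fun n => norm_nonneg _) hle hmaj.summable
  refine ⟨x, hmem, ?_, hsum, ?_⟩
  · have h1 := hsum.of_norm.hasSum
    have h2 := h1.tendsto_sum_nat.comp (tendsto_add_atTop_nat 1)
    rwa [tendsto_nhds_unique h2 hx] at h1
  · refine (hsum.tsum_le_tsum hle hmaj.summable).trans_eq ?_
    rw [hmaj.tsum_eq]
    ring

namespace FourierAlg

theorem hasSum_coeff {x y : ℕ → Lp ℂ 2 μ} {ξ η : Lp ℂ 2 μ} (hx : HasSum x ξ)
    (hy : HasSum y η) (hxs : Summable fun n => ‖x n‖) (hys : Summable fun n => ‖y n‖) :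
    HasSum (fun p : ℕ × ℕ => coeff (x p.1) (y p.2)) (coeff ξ η) := by
  have hs : Summable fun p : ℕ × ℕ => coeff (x p.1) (y p.2) :=
    Summable.of_norm_bounded (hxs.mul_of_nonneg hys (fun n => norm_nonneg _)
      fun n => norm_nonneg _) fun p => norm_coeff_le _ _
  have hL : ∀ η : Lp ℂ 2 μ, HasSum (fun n => coeff (x n) η) (coeff ξ η) := fun η =>
    hx.map (AddMonoidHom.ofMapSub (fun ξ => coeff ξ η) fun a b => coeff_sub_left a b η)
      (continuous_coeff.comp (by fun_prop : Continuous fun ξ : Lp ℂ 2 μ => (ξ, η)))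
  have hR : ∀ ξ : Lp ℂ 2 μ, HasSum (fun n => coeff ξ (y n)) (coeff ξ η) := fun ξ =>
    hy.map (AddMonoidHom.ofMapSub (fun η => coeff ξ η) fun a b => coeff_sub_right ξ a b)
      (continuous_coeff.comp (by fun_prop : Continuous fun η : Lp ℂ 2 μ => (ξ, η)))
  have := hs.hasSum.prod_fiberwise fun n => hR (x n)
  rw [(hL η).unique this]
  exact hs.hasSum

/-- Every element of `A(G)` is an absolutely convergent series of coefficients of compactly
supported continuous functions. -/
theorem exists_cc_hasSum (u : FourierAlg μ) {C : ℝ} (hC : ‖u‖ < C) :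
    ∃ ξ η : ℕ → Lp ℂ 2 μ, (∀ n, ξ n ∈ ccSubgroup μ) ∧ (∀ n, η n ∈ ccSubgroup μ) ∧
      Summable (fun n => ‖ξ n‖ * ‖η n‖) ∧ HasSum (fun n => coeff (ξ n) (η n)) u ∧
        ∑' n, ‖ξ n‖ * ‖η n‖ < C := by
  obtain ⟨ξ, η, hs, hu, hlt⟩ := exists_coeff_hasSum u hC
  obtain ⟨δ, hδ, hδC⟩ : ∃ δ > 0, (1 + δ) ^ 2 * ∑' n, ‖ξ n‖ * ‖η n‖ < C := by
    have hc : ContinuousAt (fun δ : ℝ => (1 + δ) ^ 2 * ∑' n, ‖ξ n‖ * ‖η n‖) 0 := by fun_prop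
    have := (hc.tendsto.mono_left (nhdsWithin_le_nhds (s := Set.Ioi 0))).eventually_lt_const
      (by simpa using hlt)
    obtain ⟨δ, h1, h2⟩ := (this.and self_mem_nhdsWithin).exists
    exact ⟨δ, h2, h1⟩
  choose x hx hxξ hxs hxt using fun n => exists_ccSubgroup_hasSum (ξ n) hδ
  choose y hy hyη hys hyt using fun n => exists_ccSubgroup_hasSum (η n) hδ
  have hin : ∀ n, HasSum (fun p : ℕ × ℕ => ‖x n p.1‖ * ‖y n p.2‖)
      ((∑' k, ‖x n k‖) * ∑' k, ‖y n k‖) := fun n =>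
    (hxs n).hasSum.mul (hys n).hasSum ((hxs n).mul_of_nonneg (hys n) (fun n => norm_nonneg _)
      fun n => norm_nonneg _)
  have hle : ∀ n, (∑' k, ‖x n k‖) * ∑' k, ‖y n k‖ ≤ (1 + δ) ^ 2 * (‖ξ n‖ * ‖η n‖) := fun n => by
    refine (mul_le_mul (hxt n) (hyt n) (tsum_nonneg fun k => norm_nonneg _)
      (by positivity)).trans_eq ?_
    ring
  have houter : Summable fun n => (∑' k, ‖x n k‖) * ∑' k, ‖y n k‖ :=
    Summable.of_nonneg_of_le (fun n => mul_nonneg (tsum_nonneg fun k => norm_nonneg _)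
      (tsum_nonneg fun k => norm_nonneg _)) hle (hs.mul_left _)
  have hp : Summable fun p : ℕ × ℕ × ℕ => ‖x p.1 p.2.1‖ * ‖y p.1 p.2.2‖ :=
    (summable_prod_of_nonneg fun p => by positivity).2
      ⟨fun n => (hin n).summable, houter.congr fun n => (hin n).tsum_eq.symm⟩
  have htot : ∑' p : ℕ × ℕ × ℕ, ‖x p.1 p.2.1‖ * ‖y p.1 p.2.2‖ < C := by
    rw [hp.tsum_prod' fun n => (hin n).summable, tsum_congr fun n => (hin n).tsum_eq]
    refine (houter.tsum_le_tsum hle (hs.mul_left _)).trans_lt ?_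
    rwa [tsum_mul_left]
  have hsm : Summable fun p : ℕ × ℕ × ℕ => coeff (x p.1 p.2.1) (y p.1 p.2.2) :=
    Summable.of_norm_bounded hp fun p => norm_coeff_le _ _
  have hin' : ∀ n, HasSum (fun p : ℕ × ℕ => coeff (x n p.1) (y n p.2)) (coeff (ξ n) (η n)) :=
    fun n => hasSum_coeff (hxξ n) (hyη n) (hxs n) (hys n)
  have hsum : HasSum (fun p : ℕ × ℕ × ℕ => coeff (x p.1 p.2.1) (y p.1 p.2.2)) u := by
    rw [hu.unique (hsm.hasSum.prod_fiberwise hin')]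
    exact hsm.hasSum
  obtain ⟨e⟩ : Nonempty (ℕ ≃ ℕ × ℕ × ℕ) := nonempty_equiv_of_countable
  refine ⟨fun n => x (e n).1 (e n).2.1, fun n => y (e n).1 (e n).2.2, fun n => hx _ _,
    fun n => hy _ _, (e.summable_iff (f := fun p : ℕ × ℕ × ℕ => ‖x p.1 p.2.1‖ * ‖y p.1 p.2.2‖)).2 hp,
    (e.hasSum_iff (f := fun p : ℕ × ℕ × ℕ => coeff (x p.1 p.2.1) (y p.1 p.2.2))).2 hsum, ?_⟩
  rwa [e.tsum_eq (fun p : ℕ × ℕ × ℕ => ‖x p.1 p.2.1‖ * ‖y p.1 p.2.2‖)]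

theorem exists_coeff_mul {ξ η f g : Lp ℂ 2 μ} (hξ : ξ ∈ ccSubgroup μ) (hη : η ∈ ccSubgroup μ)
    (hf : f ∈ ccSubgroup μ) (hg : g ∈ ccSubgroup μ) :
    ∃ w : FourierAlg μ, (⇑w = ⇑(coeff ξ η) * ⇑(coeff f g)) ∧
      ‖w‖ ≤ (‖ξ‖ * ‖η‖) * (‖f‖ * ‖g‖) := by
  obtain ⟨ξ, hξ, hξc, rfl⟩ := hξ
  obtain ⟨η, hη, hηc, rfl⟩ := hη
  obtain ⟨f, hf, hfc, rfl⟩ := hf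
  obtain ⟨g, hg, hgc, rfl⟩ := hg
  exact exists_coeffC_mul hξ hξc hη hηc hf hfc hg hgc

theorem mul_mem_fourierAlgebra (u v : FourierAlg μ) :
    ⇑u * ⇑v ∈ fourierAlgebra μ ∧ fourierNorm μ (⇑u * ⇑v) ≤ ‖u‖ * ‖v‖ := by
  have main : ∀ C > ‖u‖, ∀ D > ‖v‖, ⇑u * ⇑v ∈ fourierAlgebra μ ∧
      fourierNorm μ (⇑u * ⇑v) ≤ C * D := by
    intro C hC D hD
    obtain ⟨ξ, η, hξ, hη, hs, hu, hlt⟩ := exists_cc_hasSum u hC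
    obtain ⟨f, g, hf, hg, hs', hv, hlt'⟩ := exists_cc_hasSum v hD
    choose w hw hwle using fun p : ℕ × ℕ => exists_coeff_mul (hξ p.1) (hη p.1) (hf p.2) (hg p.2)
    have hmaj := hs.mul_of_nonneg hs' (fun n => by positivity) (fun n => by positivity)
    have hws : Summable fun p => ‖w p‖ :=
      Summable.of_nonneg_of_le (fun p => norm_nonneg _) hwle hmaj
    have h := hasSum_mem_fourierAlgebra (μ := μ) (u := fun p => ⇑(w p)) (v := ⇑u * ⇑v)
      (fun p => (w p).mem) hws fun s => ?_
    · refine ⟨h.1, h.2.trans ((hws.tsum_le_tsum hwle hmaj).trans ?_)⟩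
      rw [(hs.hasSum.mul hs'.hasSum hmaj).tsum_eq]
      exact mul_le_mul hlt.le hlt'.le (tsum_nonneg fun n => by positivity)
        ((norm_nonneg u).trans hC.le)
    · have h1 := hu.mapL (evalCLM s)
      have h2 := hv.mapL (evalCLM s)
      simp only [evalCLM_apply] at h1 h2
      have h3 : Summable fun p : ℕ × ℕ => coeff (ξ p.1) (η p.1) s * coeff (f p.2) (g p.2) s := by
        refine Summable.of_norm_bounded hws fun p => ?_
        have := (w p).norm_apply_le s
        rwa [hw] at this
      simpa only [hw, Pi.mul_apply] using h1.mul h2 h3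
  refine ⟨(main _ (lt_add_one _) _ (lt_add_one _)).1, ?_⟩
  have hc : Tendsto (fun ε : ℝ => (‖u‖ + ε) * (‖v‖ + ε)) (𝓝[>] 0) (𝓝 (‖u‖ * ‖v‖)) := by
    have : ContinuousAt (fun ε : ℝ => (‖u‖ + ε) * (‖v‖ + ε)) 0 := by fun_prop
    simpa using this.tendsto.mono_left (nhdsWithin_le_nhds (s := Set.Ioi 0))
  refine ge_of_tendsto hc ?_
  filter_upwards [self_mem_nhdsWithin] with ε hε
  exact (main _ (lt_add_of_pos_right _ hε) _ (lt_add_of_pos_right _ hε)).2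

instance : Mul (FourierAlg μ) := ⟨fun u v => of (⇑u * ⇑v) (mul_mem_fourierAlgebra u v).1⟩

@[simp] theorem coe_mul (u v : FourierAlg μ) : ⇑(u * v) = u * v := rfl

theorem norm_mul_le (u v : FourierAlg μ) : ‖u * v‖ ≤ ‖u‖ * ‖v‖ := (mul_mem_fourierAlgebra u v).2

/-- Multiplication by a fixed element of `A(G)`. -/
def mulCLM (u : FourierAlg μ) : FourierAlg μ →L[ℂ] FourierAlg μ :=
  LinearMap.mkContinuous
    { toFun := fun v => u * v
      map_add' := fun v w => by ext t; simp [mul_add]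
      map_smul' := fun c v => by ext t; simp [mul_left_comm] } ‖u‖ fun v => norm_mul_le u v

/-- Elements of norm less than `1` are quasi-invertible: `1 - u` has the inverse `1 + r`. -/
theorem exists_quasiInverse (u : FourierAlg μ) (hu : ‖u‖ < 1) : ∃ r : FourierAlg μ, r = u + u * r := by
  have h1 : ‖mulCLM u‖ < 1 := (LinearMap.mkContinuous_norm_le _ (norm_nonneg u) _).trans_lt hu
  obtain ⟨T, hT⟩ := (isUnit_one_sub_of_norm_lt_one h1).exists_right_inv
  refine ⟨T u, ?_⟩
  have : (T u) - u * T u = u := congrArg (fun S => S u) hT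
  rw [← sub_eq_iff_eq_add, this]

end FourierAlg

/-! ### Local units and synthesis at points -/

namespace FourierAlg

theorem coeffC_eq_zero {f g : G → ℂ} (hf : Continuous f) (hfc : HasCompactSupport f)
    (hg : Continuous g) (hgc : HasCompactSupport g) {A B : Set G} (hA : ∀ t, f t ≠ 0 → t ∈ A)
    (hB : ∀ t, g t ≠ 0 → t ∈ B) {s : G} (hs : s ∉ B * A⁻¹) :
    coeffC μ hf hfc hg hgc s = 0 := by
  rw [coeffC_apply]
  refine integral_eq_zero_of_ae (ae_of_all _ fun t => ?_)
  by_contra h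
  have h1 := hA _ (left_ne_zero_of_mul h)
  have h2 := hB t fun h0 => h (by simp [h0])
  exact hs ⟨t, h2, t⁻¹ * s, by simpa using h1, by simp⟩

theorem hasCompactSupport_coeffC {f g : G → ℂ} (hf : Continuous f) (hfc : HasCompactSupport f)
    (hg : Continuous g) (hgc : HasCompactSupport g) :
    HasCompactSupport (coeffC μ hf hfc hg hgc) :=
  HasCompactSupport.intro (hgc.isCompact.mul hfc.isCompact.inv) fun _ hs =>
    coeffC_eq_zero hf hfc hg hgc (fun _ h => subset_tsupport _ h)
      (fun _ h => subset_tsupport _ h) hs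

theorem continuous_coe (u : FourierAlg μ) : Continuous u := by
  obtain ⟨ξ, η, hs, hu, -⟩ := exists_coeff_hasSum u (lt_add_one _)
  have : ⇑u = fun t => ∑' n, coeff (ξ n) (η n) t :=
    funext fun t => (hu.mapL (evalCLM t)).tsum_eq.symm
  rw [this]
  exact continuous_tsum (fun n => continuous_regularCoeff _ _) hs
    fun n t => norm_regularCoeff_le _ _ _

/-- Functions in `A(G)` vanish at infinity. -/
theorem exists_isCompact_norm_lt (u : FourierAlg μ) {ε : ℝ} (hε : 0 < ε) :
    ∃ K : Set G, IsCompact K ∧ ∀ t ∉ K, ‖u t‖ < ε := by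
  obtain ⟨ξ, η, hξ, hη, -, hu, -⟩ := exists_cc_hasSum u (lt_add_one _)
  obtain ⟨S, hS⟩ := (hu.eventually (Metric.ball_mem_nhds u hε)).exists
  have hcs : ∀ n, HasCompactSupport (coeff (ξ n) (η n)) := fun n => by
    obtain ⟨f, hf, hfc, hfe⟩ := hξ n
    obtain ⟨g, hg, hgc, hge⟩ := hη n
    rw [← hfe, ← hge]
    exact hasCompactSupport_coeffC hf hfc hg hgc
  refine ⟨⋃ n ∈ S, tsupport (coeff (ξ n) (η n)), S.isCompact_biUnion fun n _ => hcs n,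
    fun t ht => ?_⟩
  have h0 : (∑ n ∈ S, coeff (ξ n) (η n)) t = 0 := by
    refine (map_sum (evalCLM t) (fun n => coeff (ξ n) (η n)) S).trans
      (Finset.sum_eq_zero fun n hn => ?_)
    by_contra h
    exact ht (Set.mem_biUnion hn (subset_tsupport _ h))
  have h1 := (u - ∑ n ∈ S, coeff (ξ n) (η n)).norm_apply_le t
  rw [coe_sub, Pi.sub_apply, h0, sub_zero] at h1
  rw [dist_eq_norm, norm_sub_rev] at hS
  exact h1.trans_lt hS

end FourierAlg

theorem sq_norm_toL2_le {f : G → ℂ} (hf : Continuous f) (hfc : HasCompactSupport f) {U : Set G}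
    (hU : IsOpen U) (hUμ : μ U ≠ ⊤) {C : ℝ} (hC : ∀ t, ‖f t‖ ≤ C) (h0 : ∀ t ∉ U, f t = 0) :
    ‖toL2 μ hf hfc‖ ^ 2 ≤ C ^ 2 * μ.real U := by
  rw [norm_toL2_sq]
  have : ∫ t, ‖f t‖ ^ 2 ∂μ ≤ ∫ t, U.indicator (fun _ => C ^ 2) t ∂μ := by
    refine integral_mono_of_nonneg (ae_of_all _ fun t => by positivity) ?_
      (ae_of_all _ fun t => ?_)
    · exact (integrable_indicator_iff hU.measurableSet).2 (integrableOn_const hUμ)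
    · by_cases ht : t ∈ U
      · simp only [Set.indicator_of_mem ht]
        exact pow_le_pow_left₀ (norm_nonneg _) (hC t) 2
      · simp [h0 t ht, ht]
  refine this.trans_eq ?_
  rw [integral_indicator hU.measurableSet, setIntegral_const, smul_eq_mul, mul_comm]

/-- Coefficients `⟨λ(·) f, g⟩` with `f`, `g` supported near `1` that equal `1` near `1`, of norm
bounded by a constant: `f` is essentially the normalised indicator of a compact neighbourhood `K`
of `1`, and `g` the indicator of an open set of measure less than `2 μ(K)` that contains the
translates of `K` by the elements near `1`. -/
theorem exists_coeffC_eq_one {N : Set G} (hN : N ∈ 𝓝 (1 : G)) :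
    ∃ (f g : G → ℂ) (hf : Continuous f) (hfc : HasCompactSupport f) (hg : Continuous g)
      (hgc : HasCompactSupport g), (∀ t, f t ≠ 0 → t ∈ N) ∧ (∀ t, g t ≠ 0 → t ∈ N) ∧
        ‖toL2 μ hf hfc‖ * ‖toL2 μ hg hgc‖ ≤ 2 ∧
          ∀ᶠ s in 𝓝 1, FourierAlg.coeffC μ hf hfc hg hgc s = 1 := by
  obtain ⟨K, hK1, hKN, hK⟩ := local_compact_nhds (interior_mem_nhds.2 hN)
  have hμK : μ K ≠ 0 := (Measure.measure_pos_of_mem_nhds μ hK1).ne'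
  have hμK' : μ K ≠ ⊤ := hK.measure_lt_top.ne
  have hm : 0 < μ.real K := ENNReal.toReal_pos hμK hμK'
  obtain ⟨U', hKU', hU', hU'μ⟩ := K.exists_isOpen_lt_add hμK' hμK
  set U := U' ∩ interior N with hUdef
  have hU : IsOpen U := hU'.inter isOpen_interior
  have hKU : K ⊆ U := Set.subset_inter hKU' hKN
  have hUμ' : μ U ≤ μ K + μ K := (measure_mono Set.inter_subset_left).trans hU'μ.le
  have hUμ : μ U ≠ ⊤ := ne_top_of_le_ne_top (ENNReal.add_ne_top.2 ⟨hμK', hμK'⟩) hUμ'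
  have hUreal : μ.real U ≤ 2 * μ.real K := by
    have := ENNReal.toReal_mono (ENNReal.add_ne_top.2 ⟨hμK', hμK'⟩) hUμ'
    rw [ENNReal.toReal_add hμK' hμK'] at this
    simpa [Measure.real, two_mul] using this
  obtain ⟨L, hL, hKL, hLU⟩ := exists_compact_between hK hU hKU
  obtain ⟨V, hV1, hVL⟩ := compact_open_separated_mul_left hL hU hLU
  obtain ⟨W, hW1, hWV, hW⟩ := local_compact_nhds hV1
  have hWL : W * L ⊆ U := (Set.mul_subset_mul_right hWV).trans hVL
  obtain ⟨f, hf1, hf0, hfc, hf01⟩ := exists_continuous_one_zero_of_isCompact hK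
    isOpen_interior.isClosed_compl (Set.disjoint_compl_right_iff_subset.2 hKL)
  obtain ⟨g, hg1, hg0, hgc, hg01⟩ := exists_continuous_one_zero_of_isCompact (hW.mul hL)
    hU.isClosed_compl (Set.disjoint_compl_right_iff_subset.2 hWL)
  have hfL : ∀ t, f t ≠ 0 → t ∈ L := fun t ht => by
    by_contra h
    exact ht (hf0 fun h' => h (interior_subset h'))
  have hgU : ∀ t, g t ≠ 0 → t ∈ U := fun t ht => by
    by_contra h
    exact ht (hg0 h)
  set I := ∫ t, f t ∂μ with hI
  have hIm : μ.real K ≤ I := by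
    have : ∫ t, K.indicator (fun _ => (1 : ℝ)) t ∂μ ≤ I := by
      refine integral_mono_of_nonneg (ae_of_all _ fun t => Set.indicator_nonneg (by simp) t)
        (f.continuous.integrable_of_hasCompactSupport hfc) (ae_of_all _ fun t => ?_)
      by_cases ht : t ∈ K
      · simp [ht, hf1 ht]
      · simpa [ht] using (hf01 t).1
    rwa [integral_indicator hK.measurableSet, setIntegral_const, smul_eq_mul, mul_one] at this
  have hIpos : 0 < I := hm.trans_le hIm
  have hFc : Continuous fun t => ((f t / I : ℝ) : ℂ) := by fun_prop
  have hFs : HasCompactSupport fun t => ((f t / I : ℝ) : ℂ) :=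
    hfc.comp_left (g := fun x : ℝ => ((x / I : ℝ) : ℂ)) (by simp)
  have hGc : Continuous fun t => (g t : ℂ) := by fun_prop
  have hGs : HasCompactSupport fun t => (g t : ℂ) :=
    hgc.comp_left (g := fun x : ℝ => (x : ℂ)) (by simp)
  have hF0 : ∀ t, ((f t / I : ℝ) : ℂ) ≠ 0 → t ∈ L := fun t ht => hfL t fun h => ht (by simp [h])
  have hG0 : ∀ t, (g t : ℂ) ≠ 0 → t ∈ U := fun t ht => hgU t fun h => ht (by simp [h])
  refine ⟨_, _, hFc, hFs, hGc, hGs, fun t ht => interior_subset (hLU (hF0 t ht)).2,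
    fun t ht => interior_subset (hG0 t ht).2, ?_, ?_⟩
  · have e1 := sq_norm_toL2_le (μ := μ) hFc hFs hU hUμ (C := 1 / I) (fun t => by
      rw [Complex.norm_real, Real.norm_eq_abs, abs_div, abs_of_pos hIpos,
        abs_of_nonneg (hf01 t).1]
      gcongr
      exact (hf01 t).2) (fun t ht => by
        by_contra h
        exact ht (hLU (hF0 t h)))
    have e2 := sq_norm_toL2_le (μ := μ) hGc hGs hU hUμ (C := 1) (fun t => by
      rw [Complex.norm_real, Real.norm_eq_abs, abs_of_nonneg (hg01 t).1]
      exact (hg01 t).2) (fun t ht => by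
        by_contra h
        exact ht (hG0 t h))
    refine le_of_sq_le_sq ?_ zero_le_two
    rw [mul_pow]
    calc _ ≤ ((1 / I) ^ 2 * μ.real U) * (1 ^ 2 * μ.real U) :=
          mul_le_mul e1 e2 (by positivity) (by positivity)
      _ = (μ.real U / I) ^ 2 := by ring
      _ ≤ 2 ^ 2 := by
          refine pow_le_pow_left₀ (by positivity) ?_ 2
          rw [div_le_iff₀ hIpos]
          linarith
  · filter_upwards [hW1] with s hs
    rw [FourierAlg.coeffC_apply]
    have : ∀ t, ((f (s⁻¹ * t) / I : ℝ) : ℂ) * conj (g t : ℂ) = ((f (s⁻¹ * t) / I : ℝ) : ℂ) := by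
      intro t
      by_cases h : f (s⁻¹ * t) = 0
      · simp [h]
      have : t ∈ W * L := ⟨s, hs, s⁻¹ * t, hfL _ h, by simp⟩
      simp [hg1 this]
    simp only [this]
    rw [integral_mul_left_eq_self (fun t => ((f t / I : ℝ) : ℂ)) s⁻¹, integral_complex_ofReal,
      integral_div, ← hI, div_self hIpos.ne', Complex.ofReal_one]

namespace FourierAlg

/-- On coefficients `e = ⟨λ(·) f, g⟩` of bounded norm with `f`, `g` supported near `1`,
multiplication by `u` is nearly multiplication by the scalar `u 1`. -/
theorem exists_nhds_norm_mul_sub_le (u : FourierAlg μ) {ε : ℝ} (hε : 0 < ε) :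
    ∃ N ∈ 𝓝 (1 : G), ∀ (f g : G → ℂ) (hf : Continuous f) (hfc : HasCompactSupport f)
      (hg : Continuous g) (hgc : HasCompactSupport g), (∀ t, f t ≠ 0 → t ∈ N) →
        (∀ t, g t ≠ 0 → t ∈ N) → ‖toL2 μ hf hfc‖ * ‖toL2 μ hg hgc‖ ≤ 2 →
          ‖u * coeffC μ hf hfc hg hgc - u 1 • coeffC μ hf hfc hg hgc‖ ≤ ε := by
  let P : FourierAlg μ → Prop := fun u => ∀ ε > 0,
    ∃ N ∈ 𝓝 (1 : G), ∀ (f g : G → ℂ) (hf : Continuous f) (hfc : HasCompactSupport f)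
      (hg : Continuous g) (hgc : HasCompactSupport g), (∀ t, f t ≠ 0 → t ∈ N) →
        (∀ t, g t ≠ 0 → t ∈ N) → ‖toL2 μ hf hfc‖ * ‖toL2 μ hg hgc‖ ≤ 2 →
          ‖u * coeffC μ hf hfc hg hgc - u 1 • coeffC μ hf hfc hg hgc‖ ≤ ε
  have hP0 : P 0 := fun ε hε => ⟨Set.univ, univ_mem, fun f g hf hfc hg hgc _ _ _ => by
    have : (0 : FourierAlg μ) * coeffC μ hf hfc hg hgc -
        (0 : FourierAlg μ) 1 • coeffC μ hf hfc hg hgc = 0 := by ext; simp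
    rw [this, norm_zero]
    exact hε.le⟩
  have hPadd : ∀ u v, P u → P v → P (u + v) := fun u v hu hv ε hε => by
    obtain ⟨N, hN, h⟩ := hu (ε / 2) (half_pos hε)
    obtain ⟨N', hN', h'⟩ := hv (ε / 2) (half_pos hε)
    refine ⟨N ∩ N', inter_mem hN hN', fun f g hf hfc hg hgc h1 h2 h3 => ?_⟩
    have e1 := h f g hf hfc hg hgc (fun t ht => (h1 t ht).1) (fun t ht => (h2 t ht).1) h3
    have e2 := h' f g hf hfc hg hgc (fun t ht => (h1 t ht).2) (fun t ht => (h2 t ht).2) h3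
    have : (u + v) * coeffC μ hf hfc hg hgc - (u + v) 1 • coeffC μ hf hfc hg hgc =
        (u * coeffC μ hf hfc hg hgc - u 1 • coeffC μ hf hfc hg hgc) +
        (v * coeffC μ hf hfc hg hgc - v 1 • coeffC μ hf hfc hg hgc) := by
      ext t
      simp
      ring
    rw [this]
    exact (norm_add_le _ _).trans (by linarith)
  have hPcoeff : ∀ ξ ∈ ccSubgroup μ, ∀ η ∈ ccSubgroup μ, P (coeff ξ η) := by
    rintro _ ⟨ξ, hξ, hξc, rfl⟩ _ ⟨η, hη, hηc, rfl⟩ ε hε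
    obtain ⟨δ, hδ, hδε⟩ : ∃ δ > 0, δ * (‖toL2 μ hξ hξc‖ + ‖toL2 μ hη hηc‖) * 2 ≤ ε := by
      refine ⟨ε / ((‖toL2 μ hξ hξc‖ + ‖toL2 μ hη hηc‖) * 2 + 1), by positivity, ?_⟩
      rw [mul_assoc, div_mul_eq_mul_div, div_le_iff₀ (by positivity)]
      nlinarith
    have hact : ∀ x : Lp ℂ 2 μ, {r : G | ‖DomMulAct.mk r • x - x‖ < δ} ∈ 𝓝 (1 : G) := by
      intro x
      have h2 : Fact ((2 : ENNReal) ≠ ⊤) := ⟨by simp⟩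
      have hc : Continuous fun r : G => ‖DomMulAct.mk r • x - x‖ := by
        have h : Continuous fun r : G => DomMulAct.mk r := by fun_prop
        exact ((h.smul continuous_const).sub continuous_const).norm
      exact hc.continuousAt.eventually_lt_const (by simpa using hδ)
    refine ⟨_, inter_mem (hact (toL2 μ hξ hξc)) (hact (toL2 μ hη hηc)),
      fun f g hf hfc hg hgc h1 h2 h3 => ?_⟩
    obtain ⟨w, hw, hwle⟩ := exists_coeffC_mul_sub hξ hξc hη hηc hf hfc hg hgc hδ.le
      (fun r hr => (h1 r hr).1.le) (fun r hr => (h2 r hr).2.le)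
    have : coeff (toL2 μ hξ hξc) (toL2 μ hη hηc) * coeffC μ hf hfc hg hgc -
        coeff (toL2 μ hξ hξc) (toL2 μ hη hηc) 1 • coeffC μ hf hfc hg hgc = w :=
      DFunLike.coe_injective hw.symm
    rw [this]
    refine hwle.trans (le_trans ?_ hδε)
    gcongr
  have hPlim : P u := fun ε hε => by
    obtain ⟨ξ, η, hξ, hη, -, hu, -⟩ := exists_cc_hasSum u (lt_add_one _)
    obtain ⟨S, hS⟩ := (hu.eventually (Metric.ball_mem_nhds u
      (by positivity : 0 < ε / 8))).exists
    set v := ∑ n ∈ S, coeff (ξ n) (η n) with hv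
    have hPv : P v := by
      rw [hv]
      exact Finset.sum_induction _ P hPadd hP0 fun n _ => hPcoeff _ (hξ n) _ (hη n)
    obtain ⟨N, hN, h⟩ := hPv (ε / 2) (half_pos hε)
    refine ⟨N, hN, fun f g hf hfc hg hgc h1 h2 h3 => ?_⟩
    have e1 := h f g hf hfc hg hgc h1 h2 h3
    have hS' : ‖u - v‖ < ε / 8 := by rwa [dist_eq_norm, norm_sub_rev] at hS
    set e := coeffC μ hf hfc hg hgc with he
    have hele : ‖e‖ ≤ 2 := (norm_coeff_le _ _).trans h3
    have e2 : ‖(u - v) * e‖ ≤ ε / 8 * 2 :=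
      (norm_mul_le _ _).trans (mul_le_mul hS'.le hele (norm_nonneg _) (by positivity))
    have e3 : ‖(u - v) 1 • e‖ ≤ ε / 8 * 2 := by
      rw [norm_smul]
      exact mul_le_mul (((u - v).norm_apply_le 1).trans hS'.le) hele (norm_nonneg _)
        (by positivity)
    have : u * e - u 1 • e = (u - v) * e + (v * e - v 1 • e) - (u - v) 1 • e := by
      ext t
      simp
      ring
    rw [this]
    refine (norm_sub_le _ _).trans ((add_le_add_left (norm_add_le _ _) _).trans ?_)
    linarith
  exact hPlim ε hε

/-- Synthesis at a point `x`: there are elements `e` of `A(G)` that are `1` near `x`, are supported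
close to `x`, and satisfy `u e ≈ u(x) e` in the norm of `A(G)`. -/
theorem exists_localUnit (u : FourierAlg μ) {x : G} {N : Set G} (hN : N ∈ 𝓝 x) {ε : ℝ}
    (hε : 0 < ε) :
    ∃ e : FourierAlg μ, (∀ᶠ t in 𝓝 x, e t = 1) ∧ (∀ t ∉ N, e t = 0) ∧ HasCompactSupport e ∧
      ‖u * e - u x • e‖ ≤ ε := by
  obtain ⟨N₁, hN₁, h⟩ := exists_nhds_norm_mul_sub_le (translate x⁻¹ u) hε
  have hN' : {t : G | x * t ∈ N} ∈ 𝓝 (1 : G) :=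
    (continuous_const_mul x).continuousAt (by simpa using hN)
  obtain ⟨N₂, hN₂, hN₂'⟩ : ∃ N₂ ∈ 𝓝 (1 : G), N₂ * N₂⁻¹ ⊆ {t : G | x * t ∈ N} := by
    obtain ⟨V, hV, h⟩ := exists_nhds_split_inv hN'
    refine ⟨V, hV, ?_⟩
    rintro _ ⟨a, ha, b, hb, rfl⟩
    have := h a ha b⁻¹ (by simpa using hb)
    simpa using this
  obtain ⟨f, g, hf, hfc, hg, hgc, h1, h2, h3, h4⟩ :=
    exists_coeffC_eq_one (μ := μ) (inter_mem hN₁ hN₂)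
  have h5 := h f g hf hfc hg hgc (fun t ht => (h1 t ht).1) (fun t ht => (h2 t ht).1) h3
  set e := coeffC μ hf hfc hg hgc with he
  have hx : Tendsto (fun t => x⁻¹ * t) (𝓝 x) (𝓝 1) := by
    have := (continuous_const_mul x⁻¹).tendsto x
    rwa [inv_mul_cancel] at this
  refine ⟨translate x e, hx.eventually h4, fun t ht => ?_, ?_, ?_⟩
  · refine coeffC_eq_zero hf hfc hg hgc (fun t ht => (h1 t ht).2) (fun t ht => (h2 t ht).2)
      fun hmem => ht ?_
    simpa using hN₂' hmem
  · exact (hasCompactSupport_coeffC hf hfc hg hgc).comp_homeomorph (Homeomorph.mulLeft x⁻¹)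
  · have : u * translate x e - u x • translate x e =
        translate x (translate x⁻¹ u * e - (translate x⁻¹ u) 1 • e) := by
      ext t
      simp
    rw [this]
    exact (norm_translate_le _ _).trans h5

end FourierAlg

/-! ### Feichtinger's algebra as a space of atomic sums -/

namespace FourierAlg

theorem exists_eq_one_near (x : G) {N : Set G} (hN : N ∈ 𝓝 x) :
    ∃ e : FourierAlg μ, (∀ᶠ t in 𝓝 x, e t = 1) ∧ (∀ t ∉ N, e t = 0) ∧ HasCompactSupport e := by
  obtain ⟨e, h1, h2, h3, -⟩ := exists_localUnit (0 : FourierAlg μ) hN one_pos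
  exact ⟨e, h1, h2, h3⟩

/-- The Fourier algebra is regular. -/
theorem exists_eq_one_on {K U : Set G} (hK : IsCompact K) (hU : IsOpen U) (hKU : K ⊆ U) :
    ∃ e : FourierAlg μ, HasCompactSupport e ∧ (∀ t ∈ K, e t = 1) ∧ ∀ t ∉ U, e t = 0 := by
  refine hK.induction_on (p := fun K => ∃ e : FourierAlg μ, HasCompactSupport e ∧
    (∀ t ∈ K, e t = 1) ∧ ∀ t ∉ U, e t = 0) ?_ ?_ ?_ ?_
  · exact ⟨0, HasCompactSupport.zero, by simp, by simp⟩
  · rintro s t hst ⟨e, he, h1, h2⟩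
    exact ⟨e, he, fun x hx => h1 x (hst hx), h2⟩
  · rintro s t ⟨e, he, h1, h2⟩ ⟨e', he', h1', h2'⟩
    refine ⟨e + e' - e * e', (he.add he').sub he.mul_right, ?_, fun x hx => ?_⟩
    · rintro x (hx | hx)
      · simp [h1 x hx]
      · simp [h1' x hx]
    · simp [h2 x hx, h2' x hx]
  · intro x hx
    obtain ⟨e, h1, h2, h3⟩ := exists_eq_one_near (μ := μ) x (hU.mem_nhds (hKU hx))
    exact ⟨_, mem_nhdsWithin_of_mem_nhds h1, e, h3, fun t ht => ht, h2⟩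

end FourierAlg

variable {I : Submodule ℂ (G → ℂ)}

theorem mem_segalAlgebra_of_countable {ι : Type*} [Countable ι]
    {x : ι → lp (fun _ : G => ℂ) 1} {u : ι → G → ℂ} {f : G → ℂ} (hu : ∀ i, u i ∈ I)
    (hs : Summable fun i => ‖x i‖ * fourierNorm μ (u i))
    (hf : ∀ t, HasSum (fun i => tensorMap (x i) (u i) t) (f t)) : f ∈ segalAlgebra μ I := by
  obtain ⟨k, hk⟩ := exists_injective_nat ι
  refine ⟨Function.extend k x 0, Function.extend k u 0, fun n => ?_, ?_, fun t => ?_⟩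
  · by_cases hn : ∃ i, k i = n
    · obtain ⟨i, rfl⟩ := hn
      rw [hk.extend_apply]
      exact hu i
    · rw [Function.extend_apply' _ _ _ hn]
      exact zero_mem I
  · have : (fun n => ‖Function.extend k x 0 n‖ * fourierNorm μ (Function.extend k u 0 n)) =
        Function.extend k (fun i => ‖x i‖ * fourierNorm μ (u i)) 0 := by
      funext n
      by_cases hn : ∃ i, k i = n
      · obtain ⟨i, rfl⟩ := hn
        simp only [hk.extend_apply]
      · simp [Function.extend_apply' _ _ _ hn]
    rw [this]
    exact ((hasSum_extend_zero hk).2 hs.hasSum).summable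
  · have : (fun n => tensorMap (Function.extend k x 0 n) (Function.extend k u 0 n) t) =
        Function.extend k (fun i => tensorMap (x i) (u i) t) 0 := by
      funext n
      by_cases hn : ∃ i, k i = n
      · obtain ⟨i, rfl⟩ := hn
        simp only [hk.extend_apply]
      · simp [Function.extend_apply' _ _ _ hn, tensorMap]
    rw [this, hasSum_extend_zero hk]
    exact hf t

theorem add_mem_segalAlgebra {f g : G → ℂ} (hf : f ∈ segalAlgebra μ I)
    (hg : g ∈ segalAlgebra μ I) : f + g ∈ segalAlgebra μ I := by
  obtain ⟨x, u, hu, hs, h⟩ := hf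
  obtain ⟨y, v, hv, hs', h'⟩ := hg
  refine mem_segalAlgebra_of_countable (ι := ℕ ⊕ ℕ) (x := Sum.elim x y) (u := Sum.elim u v)
    (by rintro (n | n) <;> simp [hu, hv]) ?_ fun t => ?_
  · exact (HasSum.sum (f := fun i => ‖Sum.elim x y i‖ * fourierNorm μ (Sum.elim u v i))
      hs.hasSum hs'.hasSum).summable
  · exact HasSum.sum (f := fun i => tensorMap (Sum.elim x y i) (Sum.elim u v i) t) (h t) (h' t)

theorem summable_translate_apply {w : G → FourierAlg μ} (hw : Summable fun s => ‖w s‖) (t : G) :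
    Summable fun s => w s (s⁻¹ * t) :=
  Summable.of_norm_bounded hw fun s => (w s).norm_apply_le _

/-- An absolutely convergent sum of translates of elements of `I` lies in the algebra. -/
theorem tsum_mem_segalAlgebra {a : G → FourierAlg μ} (ha : ∀ s, ⇑(a s) ∈ I)
    (hs : Summable fun s => ‖a s‖) : (fun t => ∑' s, a s (s⁻¹ * t)) ∈ segalAlgebra μ I := by
  classical
  have hcount : (Function.support fun s => ‖a s‖).Countable := hs.countable_support
  have : Countable (Function.support fun s => ‖a s‖) := hcount.to_subtype
  have hten : ∀ (s : G) (t : G), tensorMap (lp.single 1 s (1 : ℂ)) (a s) t = a s (s⁻¹ * t) := by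
    intro s t
    rw [tensorMap, tsum_eq_single s]
    · simp
    · intro r hr
      simp [hr]
  refine mem_segalAlgebra_of_countable (ι := Function.support fun s => ‖a s‖)
    (x := fun s => lp.single 1 (s : G) (1 : ℂ)) (u := fun s => a s) (fun s => ha s) ?_
    fun t => ?_
  · have h1 : ∀ s : G, ‖lp.single (E := fun _ : G => ℂ) 1 s (1 : ℂ)‖ = 1 := fun s => by
      rw [lp.norm_single] <;> simp
    simp only [h1, one_mul]
    exact hs.subtype _
  · simp only [hten]
    refine (hasSum_subtype_iff_of_support_subset (f := fun s => a s (s⁻¹ * t)) ?_).2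
      (summable_translate_apply hs t).hasSum
    intro s hs0 h0
    have : a s = 0 := by simpa using h0
    exact hs0 (by simp [this])

/-- `E` is absorbed by `I`: the sum `∑ₛ s·(wₛ E)` lies in the algebra built on `I`, for every
absolutely summable family `w` in `A(G)`. If `I` is an ideal of `A(G)`, then these `E` form a
translation invariant ideal of `A(G)` that contains `I`. -/
def IsAbsorbed (I : Submodule ℂ (G → ℂ)) (E : FourierAlg μ) : Prop :=
  ∀ w : G → FourierAlg μ, Summable (fun s => ‖w s‖) →
    (fun t => ∑' s, (w s * E) (s⁻¹ * t)) ∈ segalAlgebra μ I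

theorem summable_norm_mul_right {w : G → FourierAlg μ} (hw : Summable fun s => ‖w s‖)
    (E : FourierAlg μ) : Summable fun s => ‖w s * E‖ :=
  Summable.of_nonneg_of_le (fun _ => norm_nonneg _) (fun _ => FourierAlg.norm_mul_le _ _)
    (hw.mul_right ‖E‖)

theorem IsAbsorbed.add {E E' : FourierAlg μ} (hE : IsAbsorbed I E) (hE' : IsAbsorbed I E') :
    IsAbsorbed I (E + E') := fun w hw => by
  convert add_mem_segalAlgebra (hE w hw) (hE' w hw) using 1
  funext t
  rw [Pi.add_apply, ← (summable_translate_apply (summable_norm_mul_right hw E) t).tsum_add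
    (summable_translate_apply (summable_norm_mul_right hw E') t)]
  simp [mul_add]

theorem IsAbsorbed.mul_left {E : FourierAlg μ} (hE : IsAbsorbed I E) (a : FourierAlg μ) :
    IsAbsorbed I (a * E) := fun w hw => by
  have := hE (fun s => w s * a) (summable_norm_mul_right hw a)
  simpa [mul_assoc] using this

theorem IsCompactlySupportedIdeal.isAbsorbed_translate (hI : IsCompactlySupportedIdeal μ I)
    {v : FourierAlg μ} (hv : ⇑v ∈ I) (r : G) : IsAbsorbed I (FourierAlg.translate r v) :=
  fun w hw => by
  have h := tsum_mem_segalAlgebra (I := I)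
    (a := fun s => FourierAlg.translate r⁻¹ (w (s * r⁻¹)) * v)
    (fun s => hI.mul_mem _ (FourierAlg.mem _) _ hv) ?_
  · convert h using 1
    funext t
    rw [← (Equiv.mulRight r).tsum_eq (fun s =>
      (FourierAlg.translate r⁻¹ (w (s * r⁻¹)) * v) (s⁻¹ * t))]
    simp [mul_assoc]
  · refine summable_norm_mul_right (w := fun s => FourierAlg.translate r⁻¹ (w (s * r⁻¹))) ?_ v
    have hw' : Summable fun s => ‖w (s * r⁻¹)‖ :=
      (Equiv.mulRight r⁻¹).summable_iff (f := fun s => ‖w s‖) |>.2 hw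
    exact Summable.of_nonneg_of_le (fun s => norm_nonneg _)
      (fun s => FourierAlg.norm_translate_le _ _) hw'

/-- Local inversion: a translate of an element of `I` that does not vanish at `x` has, after
localisation, the form `1 - u` with `‖u‖ < 1`, and the Neumann series inverts it. -/
theorem IsCompactlySupportedIdeal.exists_isAbsorbed_near (hI : IsCompactlySupportedIdeal μ I)
    (x : G) : ∃ E : FourierAlg μ, IsAbsorbed I E ∧ ∀ᶠ t in 𝓝 x, E t = 1 := by
  obtain ⟨v₀, hv₀, hne⟩ := (Submodule.ne_bot_iff I).1 hI.ne_bot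
  obtain ⟨x₀, hx₀⟩ := Function.ne_iff.1 hne
  set v : FourierAlg μ := FourierAlg.translate (x * x₀⁻¹)
    ((v₀ x₀)⁻¹ • FourierAlg.of v₀ (hI.subset_fourierAlgebra _ hv₀)) with hv
  have hvabs : IsAbsorbed I v := hI.isAbsorbed_translate (I.smul_mem _ hv₀) _
  have hvx : v x = 1 := by
    simpa [hv] using inv_mul_cancel₀ hx₀
  obtain ⟨e, he, -, -⟩ := FourierAlg.exists_eq_one_near (μ := μ) x univ_mem
  obtain ⟨e', he', -, -, hsmall⟩ := FourierAlg.exists_localUnit (e - v) (x := x) univ_mem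
    (half_pos one_pos : (0 : ℝ) < 1 / 2)
  have h0 : (e - v) x = 0 := by simp [he.self_of_nhds, hvx]
  rw [h0, zero_smul, sub_zero] at hsmall
  obtain ⟨r, hr⟩ := FourierAlg.exists_quasiInverse ((e - v) * e')
    (hsmall.trans_lt (by norm_num))
  refine ⟨(e + e * r) * v, hvabs.mul_left _, ?_⟩
  filter_upwards [he, he'] with t h1 h2
  have hrt := congrArg (fun w : FourierAlg μ => w t) hr
  simp only [FourierAlg.coe_add, FourierAlg.coe_mul, FourierAlg.coe_sub, Pi.add_apply,
    Pi.mul_apply, Pi.sub_apply, h1, h2] at hrt ⊢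
  linear_combination hrt

theorem IsCompactlySupportedIdeal.exists_isAbsorbed_on (hI : IsCompactlySupportedIdeal μ I)
    {K : Set G} (hK : IsCompact K) :
    ∃ E : FourierAlg μ, IsAbsorbed I E ∧ ∀ t ∈ K, E t = 1 := by
  refine hK.induction_on (p := fun K => ∃ E : FourierAlg μ, IsAbsorbed I E ∧ ∀ t ∈ K, E t = 1)
    ?_ ?_ ?_ ?_
  · obtain ⟨E, hE, -⟩ := hI.exists_isAbsorbed_near 1
    exact ⟨E, hE, by simp⟩
  · rintro s t hst ⟨E, hE, h⟩
    exact ⟨E, hE, fun x hx => h x (hst hx)⟩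
  · rintro s t ⟨E, hE, h⟩ ⟨E', hE', h'⟩
    refine ⟨E + E' + (-E) * E', (hE.add hE').add (hE'.mul_left _), ?_⟩
    rintro x (hx | hx)
    · simp [h x hx]
    · simp [h' x hx]
  · intro x _
    obtain ⟨E, hE, h⟩ := hI.exists_isAbsorbed_near x
    exact ⟨_, mem_nhdsWithin_of_mem_nhds h, E, hE, fun t ht => ht⟩

/-- `f = ∑ₛ s·wₛ` for an absolutely summable family of elements `wₛ` of `A(G)` that are all
supported in one compact set. -/
def IsAtomicSum (μ : Measure G) [μ.IsHaarMeasure] [μ.Regular] (f : G → ℂ) : Prop :=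
  ∃ (K : Set G) (w : G → FourierAlg μ), IsCompact K ∧ (∀ s, ∀ t ∉ K, w s t = 0) ∧
    Summable (fun s => ‖w s‖) ∧ ∀ t, HasSum (fun s => w s (s⁻¹ * t)) (f t)

theorem hasSum_of_hasSum_swap {α β : Type*} {g : α → β → ℂ}
    (hg : Summable fun p : α × β => g p.1 p.2) {x : ℂ} (hx : HasSum (fun b => ∑' a, g a b) x)
    {k : α → ℂ} (hk : ∀ a, HasSum (g a) (k a)) : HasSum k x := by
  have h3 : HasSum (fun p : β × α => g p.2 p.1) (∑' p : α × β, g p.1 p.2) :=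
    (Equiv.prodComm β α).hasSum_iff (f := fun p : α × β => g p.1 p.2) |>.2 hg.hasSum
  rw [hx.unique (h3.prod_fiberwise fun b => (h3.summable.prod_factor b).hasSum)]
  exact hg.hasSum.prod_fiberwise hk

/-- Collecting the translates by the same group element in a double series. -/
theorem isAtomicSum_of_hasSum {K : Set G} (hK : IsCompact K) {c : ℕ → G → ℂ}
    {v : ℕ → FourierAlg μ} (hv : ∀ n, ∀ t ∉ K, v n t = 0)
    (hs : Summable fun p : ℕ × G => ‖c p.1 p.2‖ * ‖v p.1‖) {f : G → ℂ}
    (hf : ∀ t, HasSum (fun n => ∑' s, c n s * v n (s⁻¹ * t)) (f t)) : IsAtomicSum μ f := by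
  have hs3 : Summable fun p : G × ℕ => ‖c p.2 p.1 • v p.2‖ := by
    have h := (Equiv.prodComm G ℕ).summable_iff
      (f := fun p : ℕ × G => ‖c p.1 p.2‖ * ‖v p.1‖) |>.2 hs
    exact h.congr fun p => (norm_smul _ _).symm
  have hs4 : ∀ s, Summable fun n => ‖c n s • v n‖ := fun s => hs3.prod_factor s
  have hev : ∀ s t, HasSum (fun n => c n s * v n t) ((∑' n, c n s • v n) t) := fun s t =>
    (hs4 s).of_norm.hasSum.mapL (FourierAlg.evalCLM t)
  refine ⟨K, fun s => ∑' n, c n s • v n, hK, fun s t ht => ?_, ?_, fun t => ?_⟩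
  · rw [← (hev s t).tsum_eq]
    exact (tsum_congr fun n => by rw [hv n t ht, mul_zero]).trans tsum_zero
  · refine Summable.of_nonneg_of_le (fun s => norm_nonneg _)
      (fun s => norm_tsum_le_tsum_norm (hs4 s)) ?_
    exact ((summable_prod_of_nonneg fun p => norm_nonneg _).1 hs3).2
  · have h2 : Summable fun p : G × ℕ => c p.2 p.1 * v p.2 (p.1⁻¹ * t) :=
      Summable.of_norm_bounded hs3 fun p => by
        simpa only [FourierAlg.coe_smul, Pi.smul_apply, smul_eq_mul] using
          FourierAlg.norm_apply_le (c p.2 p.1 • v p.2) (p.1⁻¹ * t)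
    exact hasSum_of_hasSum_swap h2 (hf t) fun s => hev s _

/-- Feichtinger's algebra does not depend on the ideal used to define it. -/
theorem IsCompactlySupportedIdeal.mem_segalAlgebra_iff (hI : IsCompactlySupportedIdeal μ I)
    {f : G → ℂ} : f ∈ segalAlgebra μ I ↔ IsAtomicSum μ f := by
  constructor
  · rintro ⟨x, u, hu, hs, hf⟩
    have hx1 : ∀ n, Summable fun s => ‖x n s‖ := fun n => by
      simpa using (lp.memℓp (x n)).summable (by simp)
    have hxn : ∀ n, ‖x n‖ = ∑' s, ‖x n s‖ := fun n => by
      simpa using lp.norm_eq_tsum_rpow (p := 1) (by simp) (x n)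
    refine isAtomicSum_of_hasSum hI.isCompact_support (c := fun n s => x n s)
      (v := fun n => FourierAlg.of (u n) (hI.subset_fourierAlgebra _ (hu n))) (fun n t ht => ?_)
      ?_ hf
    · by_contra h
      exact ht (subset_closure fun h' => h (h' _ (hu n)))
    · refine (summable_prod_of_nonneg fun p => by positivity).2 ⟨fun n => ?_, ?_⟩
      · exact (hx1 n).mul_right (fourierNorm μ (u n))
      · refine hs.congr fun n => ?_
        rw [hxn, ← tsum_mul_right]
        rfl
  · rintro ⟨K, w, hK, hwK, hs, hf⟩
    obtain ⟨E, hE, hE1⟩ := hI.exists_isAbsorbed_on hK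
    convert hE w hs using 1
    funext t
    rw [← (hf t).tsum_eq]
    refine tsum_congr fun s => ?_
    by_cases h : s⁻¹ * t ∈ K
    · simp [hE1 _ h]
    · simp [hwK s _ h]

namespace IsAtomicSum

variable {f g : G → ℂ}

theorem add (hf : IsAtomicSum μ f) (hg : IsAtomicSum μ g) : IsAtomicSum μ (f + g) := by
  obtain ⟨K, w, hK, hw, hs, hf⟩ := hf
  obtain ⟨L, v, hL, hv, hs', hg⟩ := hg
  refine ⟨K ∪ L, fun s => w s + v s, hK.union hL, fun s t ht => ?_, ?_, fun t => ?_⟩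
  · simp [hw s t fun h => ht (Or.inl h), hv s t fun h => ht (Or.inr h)]
  · exact Summable.of_nonneg_of_le (fun s => norm_nonneg _) (fun s => norm_add_le _ _)
      (hs.add hs')
  · exact (hf t).add (hg t)

theorem star (hf : IsAtomicSum μ f) : IsAtomicSum μ (star f) := by
  obtain ⟨K, w, hK, hw, hs, hf⟩ := hf
  refine ⟨K, fun s => Star.star (w s), hK, fun s t ht => ?_, ?_, fun t => ?_⟩
  · simp [hw s t ht]
  · exact Summable.of_nonneg_of_le (fun s => norm_nonneg _)
      (fun s => FourierAlg.norm_star_le _) hs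
  · exact (hf t).star

theorem mul_left (hf : IsAtomicSum μ f) (a : FourierAlg μ) : IsAtomicSum μ (⇑a * f) := by
  obtain ⟨K, w, hK, hw, hs, hf⟩ := hf
  refine ⟨K, fun s => FourierAlg.translate s⁻¹ a * w s, hK, fun s t ht => ?_, ?_, fun t => ?_⟩
  · simp [hw s t ht]
  · refine Summable.of_nonneg_of_le (fun s => norm_nonneg _) (fun s => ?_) (hs.mul_left ‖a‖)
    exact (FourierAlg.norm_mul_le _ _).trans
      (mul_le_mul_of_nonneg_right (FourierAlg.norm_translate_le _ _) (norm_nonneg _))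
  · simpa using (hf t).mul_left (a t)

theorem smul (hf : IsAtomicSum μ f) (c : ℂ) : IsAtomicSum μ (c • f) := by
  obtain ⟨K, w, hK, hw, hs, hf⟩ := hf
  refine ⟨K, fun s => c • w s, hK, fun s t ht => ?_, ?_, fun t => ?_⟩
  · simp [hw s t ht]
  · simpa only [norm_smul] using hs.mul_left ‖c‖
  · exact (hf t).mul_left c

theorem exists_fourierAlg (hf : IsAtomicSum μ f) : ∃ a : FourierAlg μ, ⇑a = f := by
  obtain ⟨K, w, -, -, hs, hf⟩ := hf
  have h : Summable fun s => FourierAlg.translate s (w s) :=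
    (Summable.of_nonneg_of_le (fun s => norm_nonneg _)
      (fun s => FourierAlg.norm_translate_le _ _) hs).of_norm
  refine ⟨∑' s, FourierAlg.translate s (w s), funext fun t => ?_⟩
  exact (h.hasSum.mapL (FourierAlg.evalCLM t)).unique (hf t)

end IsAtomicSum

theorem FourierAlg.isAtomicSum (a : FourierAlg μ) (ha : HasCompactSupport a) :
    IsAtomicSum μ a := by
  classical
  refine ⟨tsupport a, fun s => if s = 1 then a else 0, ha, fun s t ht => ?_, ?_, fun t => ?_⟩
  · by_cases hs : s = 1 <;> simp [hs, image_eq_zero_of_notMem_tsupport ht]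
  · refine summable_of_hasFiniteSupport ((Set.finite_singleton (1 : G)).subset fun s hs => ?_)
    by_contra h
    exact hs (by simp [show s ≠ 1 from h])
  · convert hasSum_ite_eq (1 : G) (a t) using 2 with s
    by_cases hs : s = 1 <;> simp [hs]

/-! ### Ring isomorphisms between regular function algebras -/

/-- The properties of a self-adjoint algebra `S` of continuous functions vanishing at infinity
that determine its `*`-ring isomorphisms: it contains functions equal to `1` on a given compact
set and to `0` off a given neighbourhood of that set, and a function that vanishes at `x` has a
quasi-invertible germ at `x`. As `S` is closed under scalar multiplication, the bound `1` in
`exists_isCompact` expresses that its elements vanish at infinity. -/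
structure IsRegularAlgebra {X : Type*} [TopologicalSpace X] (S : Set (X → ℂ)) : Prop where
  add_mem : ∀ u ∈ S, ∀ v ∈ S, u + v ∈ S
  smul_mem : ∀ c : ℂ, ∀ u ∈ S, c • u ∈ S
  star_mem : ∀ u ∈ S, star u ∈ S
  mul_mem : ∀ u ∈ S, ∀ v ∈ S, u * v ∈ S
  continuous : ∀ u ∈ S, Continuous u
  exists_isCompact : ∀ u ∈ S, ∃ K : Set X, IsCompact K ∧ ∀ t ∉ K, ‖u t‖ < 1
  exists_eq_one_on : ∀ K U : Set X, IsCompact K → IsOpen U → K ⊆ U →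
    ∃ e ∈ S, (∀ t ∈ K, e t = 1) ∧ ∀ t ∉ U, e t = 0
  exists_quasiInverse : ∀ u ∈ S, ∀ x, u x = 0 →
    ∃ u' ∈ S, ∃ r ∈ S, u' =ᶠ[𝓝 x] u ∧ r = u' + u' * r

/-- `Φ` restricts to a `*`-ring isomorphism from `S` onto `T`. -/
structure IsStarRingBij {X Y : Type*} (S : Set (X → ℂ)) (T : Set (Y → ℂ))
    (Φ : (X → ℂ) → Y → ℂ) : Prop where
  bijOn : Set.BijOn Φ S T
  map_add : ∀ u ∈ S, ∀ v ∈ S, Φ (u + v) = Φ u + Φ v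
  map_star : ∀ u ∈ S, Φ (star u) = star (Φ u)
  map_mul : ∀ u ∈ S, ∀ v ∈ S, Φ (u * v) = Φ u * Φ v

theorem ringHom_eq_id_or_conj (τ : ℂ →+* ℂ) (h : ∀ z, τ (conj z) = conj (τ z)) :
    (∀ z, τ z = z) ∨ ∀ z, τ z = conj z := by
  have hre : ∀ r : ℝ, ((τ r).re : ℂ) = τ r := fun r => by
    rw [← Complex.conj_eq_iff_re, ← h, Complex.conj_ofReal]
  -- `ℝ` has no ring endomorphism other than the identity
  let ρ : ℝ →+* ℝ :=
    { toFun := fun r => (τ r).re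
      map_one' := by simp
      map_zero' := by simp
      map_add' := fun a b => by simp
      map_mul' := fun a b => by
        apply Complex.ofReal_injective
        rw [hre, Complex.ofReal_mul, map_mul, Complex.ofReal_mul, hre, hre] }
  have hρ : ∀ r : ℝ, τ r = r := fun r => by
    rw [← hre, show (τ r).re = ρ r from rfl, Subsingleton.elim ρ (RingHom.id ℝ), RingHom.id_apply]
  let f : ℂ →ₐ[ℝ] ℂ := { τ with commutes' := hρ }
  rcases Complex.real_algHom_eq_id_or_conj f with hf | hf
  · exact Or.inl fun z => congrArg (fun g : ℂ →ₐ[ℝ] ℂ => g z) hf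
  · exact Or.inr fun z => congrArg (fun g : ℂ →ₐ[ℝ] ℂ => g z) hf

section

variable {X Y : Type*} [TopologicalSpace X] [TopologicalSpace Y]
  {S : Set (X → ℂ)} {T : Set (Y → ℂ)} {Φ : (X → ℂ) → Y → ℂ}

namespace IsRegularAlgebra

theorem exists_apply_eq_one (hS : IsRegularAlgebra S) {x : X} {U : Set X} (hU : U ∈ 𝓝 x) :
    ∃ e ∈ S, e x = 1 ∧ ∀ t ∉ U, e t = 0 := by
  obtain ⟨e, he, h1, h0⟩ := hS.exists_eq_one_on {x} (interior U) isCompact_singleton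
    isOpen_interior (by simpa using mem_interior_iff_mem_nhds.2 hU)
  exact ⟨e, he, h1 x rfl, fun t ht => h0 t fun h => ht (interior_subset h)⟩

theorem zero_mem (hS : IsRegularAlgebra S) : (0 : X → ℂ) ∈ S := by
  obtain ⟨e, he, -⟩ := hS.exists_eq_one_on ∅ Set.univ isCompact_empty isOpen_univ (by simp)
  simpa using hS.smul_mem 0 e he

theorem sub_mem (hS : IsRegularAlgebra S) {u v : X → ℂ} (hu : u ∈ S) (hv : v ∈ S) :
    u - v ∈ S := by
  simpa [sub_eq_add_neg] using hS.add_mem u hu _ (hS.smul_mem (-1) v hv)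

end IsRegularAlgebra

namespace IsStarRingBij

theorem map_zero (h : IsStarRingBij S T Φ) (hS : IsRegularAlgebra S) : Φ 0 = 0 := by
  simpa using h.map_add 0 hS.zero_mem 0 hS.zero_mem

theorem map_sub (h : IsStarRingBij S T Φ) (hS : IsRegularAlgebra S) {u v : X → ℂ} (hu : u ∈ S)
    (hv : v ∈ S) : Φ (u - v) = Φ u - Φ v := by
  rw [eq_sub_iff_add_eq, ← h.map_add _ (hS.sub_mem hu hv) _ hv, sub_add_cancel]

theorem symm (h : IsStarRingBij S T Φ) (hS : IsRegularAlgebra S) :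
    ∃ Ψ : (Y → ℂ) → X → ℂ, IsStarRingBij T S Ψ ∧ (∀ u ∈ S, Ψ (Φ u) = u) := by
  have hinv := h.bijOn.invOn_invFunOn
  have hl : ∀ u ∈ S, Function.invFunOn Φ S (Φ u) = u := fun u hu => hinv.1 hu
  refine ⟨Function.invFunOn Φ S, ⟨(Set.bijOn_comm hinv).2 h.bijOn, ?_, ?_, ?_⟩, hl⟩
  · intro u' hu' v' hv'
    obtain ⟨u, hu, rfl⟩ := h.bijOn.surjOn hu'
    obtain ⟨v, hv, rfl⟩ := h.bijOn.surjOn hv'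
    rw [← h.map_add u hu v hv, hl _ hu, hl _ hv, hl _ (hS.add_mem u hu v hv)]
  · intro u' hu'
    obtain ⟨u, hu, rfl⟩ := h.bijOn.surjOn hu'
    rw [← h.map_star u hu, hl _ hu, hl _ (hS.star_mem u hu)]
  · intro u' hu' v' hv'
    obtain ⟨u, hu, rfl⟩ := h.bijOn.surjOn hu'
    obtain ⟨v, hv, rfl⟩ := h.bijOn.surjOn hv'
    rw [← h.map_mul u hu v hv, hl _ hu, hl _ hv, hl _ (hS.mul_mem u hu v hv)]

/-- Functions of compact support are those with a local unit `e`, `e u = u`; this algebraic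
property is reflected by `Φ`. -/
theorem exists_compactSupport (h : IsStarRingBij S T Φ) (hS : IsRegularAlgebra S)
    (hT : IsRegularAlgebra T) [LocallyCompactSpace Y] (y : Y) :
    ∃ w ∈ S, Φ w y = 1 ∧ ∃ K : Set X, IsCompact K ∧ ∀ t ∉ K, w t = 0 := by
  obtain ⟨C, hC, hCy⟩ := exists_compact_mem_nhds y
  obtain ⟨v, hv, hv1, hv0⟩ := hT.exists_apply_eq_one hCy
  obtain ⟨e', he', he1, -⟩ := hT.exists_eq_one_on C Set.univ hC isOpen_univ (Set.subset_univ _)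
  obtain ⟨w, hw, rfl⟩ := h.bijOn.surjOn hv
  obtain ⟨e, he, rfl⟩ := h.bijOn.surjOn he'
  have hew : e * w = w := by
    refine h.bijOn.injOn (hS.mul_mem e he w hw) hw ?_
    rw [h.map_mul e he w hw]
    funext t
    by_cases ht : t ∈ C
    · simp [he1 t ht]
    · simp [hv0 t ht]
  obtain ⟨K, hK, hK1⟩ := hS.exists_isCompact e he
  refine ⟨w, hw, hv1, K, hK, fun t ht => ?_⟩
  by_contra hwt
  have h1 : e t = 1 := mul_right_cancel₀ hwt (by simpa using congrFun hew t)
  simpa [h1] using hK1 t ht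

/-- The functional `u ↦ Φ u y` is concentrated at a point. Otherwise every point has a
neighbourhood on which some function outside the kernel vanishes, and a finite product of such
functions annihilates a compactly supported function outside the kernel. -/
theorem exists_germ (h : IsStarRingBij S T Φ) (hS : IsRegularAlgebra S)
    (hT : IsRegularAlgebra T) [LocallyCompactSpace Y] (y : Y) :
    ∃ x : X, ∀ u ∈ S, u =ᶠ[𝓝 x] 0 → Φ u y = 0 := by
  by_contra! hcon
  obtain ⟨w, hw, hwy, K, hK, hwK⟩ := h.exists_compactSupport hS hT y
  have key : ∃ u ∈ S, (∀ t ∈ K, u t = 0) ∧ Φ u y ≠ 0 := by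
    refine hK.induction_on (p := fun K => ∃ u ∈ S, (∀ t ∈ K, u t = 0) ∧ Φ u y ≠ 0) ?_ ?_ ?_ ?_
    · exact ⟨w, hw, by simp, by simp [hwy]⟩
    · rintro s t hst ⟨u, hu, h0, hne⟩
      exact ⟨u, hu, fun x hx => h0 x (hst hx), hne⟩
    · rintro s t ⟨u, hu, h0, hne⟩ ⟨v, hv, h0', hne'⟩
      refine ⟨u * v, hS.mul_mem u hu v hv, ?_, ?_⟩
      · rintro x (hx | hx)
        · simp [h0 x hx]
        · simp [h0' x hx]
      · rw [h.map_mul u hu v hv]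
        exact mul_ne_zero hne hne'
    · intro x _
      obtain ⟨u, hu, h0, hne⟩ := hcon x
      exact ⟨_, mem_nhdsWithin_of_mem_nhds h0, u, hu, fun t ht => ht, hne⟩
  obtain ⟨u, hu, h0, hne⟩ := key
  have huw : u * w = 0 := by
    funext t
    by_cases ht : t ∈ K
    · simp [h0 t ht]
    · simp [hwK t ht]
  have h1 := congrFun (h.map_mul u hu w hw) y
  rw [huw, h.map_zero hS, Pi.mul_apply, hwy, mul_one] at h1
  exact hne h1.symm

/-- The functional `u ↦ Φ u y` vanishes on all functions that vanish at its point of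
concentration, since `1` is not the value at `y` of a quasi-invertible element. -/
theorem exists_point (h : IsStarRingBij S T Φ) (hS : IsRegularAlgebra S)
    (hT : IsRegularAlgebra T) [LocallyCompactSpace Y] (y : Y) :
    ∃ x : X, ∀ u ∈ S, u x = 0 → Φ u y = 0 := by
  obtain ⟨x, hx⟩ := h.exists_germ hS hT y
  refine ⟨x, fun u hu hux => ?_⟩
  by_contra hc
  obtain ⟨v, hv, hv1, -⟩ := hT.exists_apply_eq_one (x := y) univ_mem
  obtain ⟨w, hw, hwv⟩ := h.bijOn.surjOn (hT.smul_mem (Φ u y)⁻¹ v hv)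
  have hp := hS.mul_mem u hu w hw
  have hpy : Φ (u * w) y = 1 := by
    rw [h.map_mul u hu w hw, hwv]
    simp [hv1, hc]
  obtain ⟨p, hpS, r, hr, hpu, hrp⟩ := hS.exists_quasiInverse _ hp x (by simp [hux])
  have hpy' : Φ p y = 1 := by
    have := hx _ (hS.sub_mem hpS hp) (hpu.mono fun t ht => by simp [ht])
    rw [h.map_sub hS hpS hp, Pi.sub_apply, hpy, sub_eq_zero] at this
    exact this
  have h1 := congrFun (congrArg Φ hrp) y
  rw [h.map_add p hpS _ (hS.mul_mem p hpS r hr), h.map_mul p hpS r hr, Pi.add_apply,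
    Pi.mul_apply, hpy'] at h1
  simp at h1

theorem exists_eval_or_conj (h : IsStarRingBij S T Φ) (hS : IsRegularAlgebra S)
    (hT : IsRegularAlgebra T) [LocallyCompactSpace Y] (y : Y) :
    ∃ x : X, (∀ u ∈ S, Φ u y = u x) ∨ ∀ u ∈ S, Φ u y = conj (u x) := by
  obtain ⟨x, hx⟩ := h.exists_point hS hT y
  have heq : ∀ u ∈ S, ∀ v ∈ S, u x = v x → Φ u y = Φ v y := fun u hu v hv huv => by
    have := hx _ (hS.sub_mem hu hv) (by simp [huv])
    rwa [h.map_sub hS hu hv, Pi.sub_apply, sub_eq_zero] at this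
  obtain ⟨e, he, hex, -⟩ := hS.exists_apply_eq_one (x := x) univ_mem
  obtain ⟨w, hw, hwy, -⟩ := h.exists_compactSupport hS hT y
  have hce : ∀ c : ℂ, c • e ∈ S := fun c => hS.smul_mem c e he
  let τ : ℂ →+* ℂ :=
    { toFun := fun c => Φ (c • e) y
      map_one' := by
        have := heq (e * w) (hS.mul_mem e he w hw) w hw (by simp [hex])
        rw [h.map_mul e he w hw, Pi.mul_apply, hwy, mul_one] at this
        simpa using this
      map_zero' := by
        rw [zero_smul, h.map_zero hS, Pi.zero_apply]
      map_add' := fun a b => by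
        rw [add_smul, h.map_add _ (hce a) _ (hce b), Pi.add_apply]
      map_mul' := fun a b => by
        rw [← Pi.mul_apply, ← h.map_mul _ (hce a) _ (hce b)]
        exact heq _ (hce _) _ (hS.mul_mem _ (hce a) _ (hce b)) (by simp [hex]) }
  have hτ : ∀ u ∈ S, Φ u y = τ (u x) := fun u hu => heq u hu _ (hce _) (by simp [hex])
  have hconj : ∀ z, τ (conj z) = conj (τ z) := fun z => by
    have h1 : τ (conj z) = Φ (star (z • e)) y :=
      heq _ (hce _) _ (hS.star_mem _ (hce z)) (by simp [hex])
    rw [h1, h.map_star _ (hce z)]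
    rfl
  refine ⟨x, ?_⟩
  rcases ringHom_eq_id_or_conj τ hconj with h1 | h1
  · exact Or.inl fun u hu => (hτ u hu).trans (h1 _)
  · exact Or.inr fun u hu => (hτ u hu).trans (h1 _)

/-- The point map of a `*`-ring isomorphism between regular algebras is continuous: the sets
`{u ≠ 0}` with `u` in the algebra form a base, and `{Φ u ≠ 0}` is the preimage of `{u ≠ 0}`. -/
theorem continuous_of_norm_eq (h : IsStarRingBij S T Φ) (hS : IsRegularAlgebra S)
    (hT : IsRegularAlgebra T) {α : Y → X} (hα : ∀ u ∈ S, ∀ y, ‖Φ u y‖ = ‖u (α y)‖) :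
    Continuous α := by
  refine continuous_iff_continuousAt.2 fun y U hU => ?_
  obtain ⟨e, he, h1, h0⟩ := hS.exists_apply_eq_one hU
  have hopen : IsOpen {z | Φ e z ≠ 0} :=
    isOpen_ne_fun (hT.continuous _ (h.bijOn.mapsTo he)) continuous_const
  change α ⁻¹' U ∈ 𝓝 y
  refine mem_of_superset (hopen.mem_nhds ?_) fun z hz => ?_
  · change Φ e y ≠ 0
    rw [← norm_ne_zero_iff, hα e he, h1]
    simp
  · by_contra hzU
    change Φ e z ≠ 0 at hz
    rw [← norm_ne_zero_iff, hα e he, h0 _ hzU] at hz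
    simp at hz

theorem leftInverse_of_norm_eq (h : IsStarRingBij S T Φ) (hS : IsRegularAlgebra S) [T2Space X]
    {Ψ : (Y → ℂ) → X → ℂ} (hinv : ∀ u ∈ S, Ψ (Φ u) = u) {α : Y → X} {β : X → Y}
    (hα : ∀ u ∈ S, ∀ y, ‖Φ u y‖ = ‖u (α y)‖) (hβ : ∀ v ∈ T, ∀ x, ‖Ψ v x‖ = ‖v (β x)‖) (x : X) :
    α (β x) = x := by
  by_contra hne
  obtain ⟨e, he, h1, h0⟩ := hS.exists_apply_eq_one (isOpen_ne.mem_nhds (Ne.symm hne))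
  have h2 := hβ (Φ e) (h.bijOn.mapsTo he) x
  rw [hinv e he, hα e he, h1, h0 _ (by simp)] at h2
  simp at h2

/-- A `*`-ring isomorphism between regular algebras is composition with a homeomorphism, followed
by complex conjugation on part of the space. -/
theorem exists_homeomorph (h : IsStarRingBij S T Φ) (hS : IsRegularAlgebra S)
    (hT : IsRegularAlgebra T) [LocallyCompactSpace X] [LocallyCompactSpace Y] [T2Space X]
    [T2Space Y] :
    ∃ α : Y ≃ₜ X, ∀ y, (∀ u ∈ S, Φ u y = u (α y)) ∨ ∀ u ∈ S, Φ u y = conj (u (α y)) := by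
  obtain ⟨Ψ, hΨ, hinv⟩ := h.symm hS
  have hinv' : ∀ v ∈ T, Φ (Ψ v) = v := fun v hv => by
    obtain ⟨u, hu, rfl⟩ := h.bijOn.surjOn hv
    rw [hinv u hu]
  choose α hα using h.exists_eval_or_conj hS hT
  choose β hβ using hΨ.exists_eval_or_conj hT hS
  have hα' : ∀ u ∈ S, ∀ y, ‖Φ u y‖ = ‖u (α y)‖ := fun u hu y => by
    rcases hα y with h1 | h1 <;> simp [h1 u hu]
  have hβ' : ∀ v ∈ T, ∀ x, ‖Ψ v x‖ = ‖v (β x)‖ := fun v hv x => by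
    rcases hβ x with h1 | h1 <;> simp [h1 v hv]
  exact ⟨{
    toFun := α
    invFun := β
    left_inv := hΨ.leftInverse_of_norm_eq hT hinv' hβ' hα'
    right_inv := h.leftInverse_of_norm_eq hS hinv hα' hβ'
    continuous_toFun := h.continuous_of_norm_eq hS hT hα'
    continuous_invFun := hΨ.continuous_of_norm_eq hT hS hβ' }, hα⟩

end IsStarRingBij

end

/-! ### Isomorphisms of Feichtinger's algebra -/

namespace IsCompactlySupportedIdeal

theorem mem_of_hasCompactSupport (hI : IsCompactlySupportedIdeal μ I) (a : FourierAlg μ)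
    (ha : HasCompactSupport a) : ⇑a ∈ segalAlgebra μ I :=
  hI.mem_segalAlgebra_iff.2 (a.isAtomicSum ha)

theorem isRegularAlgebra (hI : IsCompactlySupportedIdeal μ I) :
    IsRegularAlgebra (segalAlgebra μ I) where
  add_mem u hu v hv := add_mem_segalAlgebra hu hv
  smul_mem c u hu := hI.mem_segalAlgebra_iff.2 ((hI.mem_segalAlgebra_iff.1 hu).smul c)
  star_mem u hu := hI.mem_segalAlgebra_iff.2 (hI.mem_segalAlgebra_iff.1 hu).star
  mul_mem u hu v hv := by
    obtain ⟨a, rfl⟩ := (hI.mem_segalAlgebra_iff.1 hu).exists_fourierAlg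
    exact hI.mem_segalAlgebra_iff.2 ((hI.mem_segalAlgebra_iff.1 hv).mul_left a)
  continuous u hu := by
    obtain ⟨a, rfl⟩ := (hI.mem_segalAlgebra_iff.1 hu).exists_fourierAlg
    exact a.continuous_coe
  exists_isCompact u hu := by
    obtain ⟨a, rfl⟩ := (hI.mem_segalAlgebra_iff.1 hu).exists_fourierAlg
    exact a.exists_isCompact_norm_lt one_pos
  exists_eq_one_on K U hK hU hKU := by
    obtain ⟨e, he, h1, h0⟩ := FourierAlg.exists_eq_one_on (μ := μ) hK hU hKU
    exact ⟨e, hI.mem_of_hasCompactSupport e he, h1, h0⟩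
  exists_quasiInverse u hu x hux := by
    obtain ⟨a, rfl⟩ := (hI.mem_segalAlgebra_iff.1 hu).exists_fourierAlg
    obtain ⟨e, he, -, hec, hsmall⟩ := a.exists_localUnit (x := x) univ_mem
      (half_pos one_pos : (0 : ℝ) < 1 / 2)
    rw [hux, zero_smul, sub_zero] at hsmall
    obtain ⟨r, hr⟩ := (a * e).exists_quasiInverse (hsmall.trans_lt (by norm_num))
    have hae : HasCompactSupport (a * e : FourierAlg μ) := hec.mul_left
    have hr' : ⇑r = ⇑(a * e) + ⇑(a * e) * ⇑r := congrArg (fun w : FourierAlg μ => ⇑w) hr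
    have hrc : HasCompactSupport r := by
      rw [hr']
      exact hae.add hae.mul_right
    refine ⟨_, hI.mem_of_hasCompactSupport _ hae, _, hI.mem_of_hasCompactSupport _ hrc, ?_, hr'⟩
    exact he.mono fun t ht => by simp [ht]

/-- Convolutions of compactly supported elements of `A(G)` are coefficients of compactly supported
continuous functions. -/
theorem conv_mem (hI : IsCompactlySupportedIdeal μ I) (u v : FourierAlg μ)
    (hu : HasCompactSupport u) (hv : HasCompactSupport v) : conv μ u v ∈ segalAlgebra μ I := by
  have hfc : HasCompactSupport fun t => v t⁻¹ := hv.comp_homeomorph (Homeomorph.inv G)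
  have hgc : HasCompactSupport fun t => conj (u t) :=
    hu.comp_left (g := fun z => conj z) (by simp)
  have hf : Continuous fun t => v t⁻¹ := v.continuous_coe.comp continuous_inv
  have hg : Continuous fun t => conj (u t) := Complex.continuous_conj.comp u.continuous_coe
  have : conv μ u v = FourierAlg.coeffC μ hf hfc hg hgc := by
    funext s
    rw [FourierAlg.coeffC_apply, conv]
    congr! 2 with t
    simp [mul_comm]
  rw [this]
  exact hI.mem_of_hasCompactSupport _ (FourierAlg.hasCompactSupport_coeffC hf hfc hg hgc)

end IsCompactlySupportedIdeal

namespace FourierAlg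

/-- Nonnegative functions in `A(G)` with support near a given point. -/
theorem exists_nonneg {x : G} {U : Set G} (hU : U ∈ 𝓝 x) :
    ∃ (u : FourierAlg μ) (p : G → ℝ), HasCompactSupport u ∧ (∀ t, u t = p t) ∧ Continuous p ∧
      HasCompactSupport p ∧ (∀ t, 0 ≤ p t) ∧ p x = 1 ∧ ∀ t ∉ U, p t = 0 := by
  obtain ⟨e, h1, h0, hc⟩ := exists_eq_one_near (μ := μ) x hU
  have hec := e.continuous_coe
  refine ⟨star e * e, fun t => ‖e t‖ ^ 2, hc.mul_left, fun t => ?_, by fun_prop,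
    hc.comp_left (g := fun z => ‖z‖ ^ 2) (by simp), fun t => by positivity, ?_, fun t ht => ?_⟩
  · simpa using Complex.conj_mul' (e t)
  · simp [h1.self_of_nhds]
  · simp [h0 t ht]

end FourierAlg

variable {H : Type*} [Group H] [TopologicalSpace H] [IsTopologicalGroup H] [LocallyCompactSpace H]
  [T2Space H] [MeasurableSpace H] [BorelSpace H] {ν : Measure H} [ν.IsHaarMeasure] [ν.Regular]

/-- A homeomorphism that intertwines convolution, up to complex conjugation, is multiplicative:
for nonnegative functions the convolution `u ∗ v` is nonzero precisely on `{u ≠ 0} {v ≠ 0}`. -/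
theorem map_mul_of_conv (hI : IsCompactlySupportedIdeal μ I) {Φ : (G → ℂ) → H → ℂ}
    (hconv : ∀ u ∈ segalAlgebra μ I, ∀ v ∈ segalAlgebra μ I,
      Φ (conv μ u v) = conv ν (Φ u) (Φ v)) (α : H ≃ₜ G)
    (hα : ∀ y, (∀ u ∈ segalAlgebra μ I, Φ u y = u (α y)) ∨
      ∀ u ∈ segalAlgebra μ I, Φ u y = conj (u (α y))) (a b : H) : α (a * b) = α a * α b := by
  by_contra hne
  have hnhds : {p : G × G | p.1 * p.2 ≠ α (a * b)} ∈ 𝓝 (α a, α b) :=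
    (isOpen_ne_fun continuous_mul continuous_const).mem_nhds (Ne.symm hne)
  obtain ⟨U, hU, V, hV, hUV⟩ := mem_nhds_prod_iff.1 hnhds
  obtain ⟨u, p, huc, hup, hp, hpc, hp0, hp1, hpU⟩ := FourierAlg.exists_nonneg (μ := μ) hU
  obtain ⟨v, q, hvc, hvq, hq, hqc, hq0, hq1, hqV⟩ := FourierAlg.exists_nonneg (μ := μ) hV
  have huS := hI.mem_of_hasCompactSupport u huc
  have hvS := hI.mem_of_hasCompactSupport v hvc
  have hΦu : ∀ y, Φ u y = p (α y) := fun y => by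
    rcases hα y with h | h <;> simp [h _ huS, hup]
  have hΦv : ∀ y, Φ v y = q (α y) := fun y => by
    rcases hα y with h | h <;> simp [h _ hvS, hvq]
  -- the supports of `u` and `v` are so small that `u ∗ v` vanishes at `α (a b)`
  have hzero : conv μ u v (α (a * b)) = 0 := by
    refine integral_eq_zero_of_ae (ae_of_all _ fun y => ?_)
    by_contra h0
    have h1 : y ∈ U := by
      by_contra h
      exact h0 (by simp [hup, hpU y h])
    have h2 : y⁻¹ * α (a * b) ∈ V := by
      by_contra h
      exact h0 (by simp [hvq, hqV _ h])
    exact hUV (show (y, y⁻¹ * α (a * b)) ∈ U ×ˢ V from ⟨h1, h2⟩) (by simp)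
  have hΦ0 : Φ (conv μ u v) (a * b) = 0 := by
    rcases hα (a * b) with h | h <;> simp [h _ (hI.conv_mem u v huc hvc), hzero]
  have hpos : 0 < ∫ y, p (α y) * q (α (y⁻¹ * (a * b))) ∂ν := by
    refine Continuous.integral_pos_of_hasCompactSupport_nonneg_nonzero (x := a) ?_ ?_ ?_ ?_
    · exact (hp.comp α.continuous).mul (hq.comp (α.continuous.comp (by fun_prop)))
    · exact (hpc.comp_homeomorph α).mul_right
    · exact fun y => mul_nonneg (hp0 _) (hq0 _)
    · simp [hp1, hq1]
  rw [hconv _ huS _ hvS, conv] at hΦ0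
  simp only [hΦu, hΦv, ← Complex.ofReal_mul] at hΦ0
  rw [integral_complex_ofReal, Complex.ofReal_eq_zero] at hΦ0
  exact hpos.ne' hΦ0

end Feichtinger

end

theorem mainTheorem2
    {G : Type*} [Group G] [TopologicalSpace G] [IsTopologicalGroup G] [LocallyCompactSpace G]
    [T2Space G] [MeasurableSpace G] [BorelSpace G]
    {H : Type*} [Group H] [TopologicalSpace H] [IsTopologicalGroup H] [LocallyCompactSpace H]
    [T2Space H] [MeasurableSpace H] [BorelSpace H]
    (μ : Measure G) [μ.IsHaarMeasure] [μ.Regular]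
    (ν : Measure H) [ν.IsHaarMeasure] [ν.Regular]
    (I : Submodule ℂ (G → ℂ)) (hI : Feichtinger.IsCompactlySupportedIdeal μ I)
    (J : Submodule ℂ (H → ℂ)) (hJ : Feichtinger.IsCompactlySupportedIdeal ν J)
    (Φ : (G → ℂ) → (H → ℂ))
    (hbij : Set.BijOn Φ (Feichtinger.segalAlgebra μ I) (Feichtinger.segalAlgebra ν J))
    (hadd : ∀ u ∈ Feichtinger.segalAlgebra μ I, ∀ v ∈ Feichtinger.segalAlgebra μ I,
      Φ (u + star v) = Φ u + star (Φ v))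
    (hmul : ∀ u ∈ Feichtinger.segalAlgebra μ I, ∀ v ∈ Feichtinger.segalAlgebra μ I,
      Φ (u * v) = Φ u * Φ v)
    (hconv : ∀ u ∈ Feichtinger.segalAlgebra μ I, ∀ v ∈ Feichtinger.segalAlgebra μ I,
      Φ (Feichtinger.conv μ u v) = Feichtinger.conv ν (Φ u) (Φ v)) :
    ∃ (H₁ H₂ : Set H) (α : H ≃ₜ* G),
      H₁ ∪ H₂ = Set.univ ∧ Disjoint H₁ H₂ ∧
        ∀ u ∈ Feichtinger.segalAlgebra μ I,
          Φ u = H₁.indicator (u ∘ α) + H₂.indicator (star (u ∘ α)) := by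
  have hS := hI.isRegularAlgebra
  have hT := hJ.isRegularAlgebra
  have h0 : Φ 0 = 0 := by
    have := hadd 0 hS.zero_mem 0 hS.zero_mem
    simpa using this
  have hstar : ∀ u ∈ Feichtinger.segalAlgebra μ I, Φ (star u) = star (Φ u) := fun u hu => by
    simpa [h0] using hadd 0 hS.zero_mem u hu
  have hΦ : Feichtinger.IsStarRingBij (Feichtinger.segalAlgebra μ I)
      (Feichtinger.segalAlgebra ν J) Φ :=
    { bijOn := hbij
      map_add := fun u hu v hv => by
        have := hadd u hu (star v) (hS.star_mem v hv)
        rwa [star_star, hstar v hv, star_star] at this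
      map_star := hstar
      map_mul := hmul }
  obtain ⟨α, hα⟩ := hΦ.exists_homeomorph hS hT
  refine ⟨{y | ∀ u ∈ Feichtinger.segalAlgebra μ I, Φ u y = u (α y)},
    {y | ∀ u ∈ Feichtinger.segalAlgebra μ I, Φ u y = u (α y)}ᶜ,
    { α with map_mul' := Feichtinger.map_mul_of_conv hI hconv α hα },
    Set.union_compl_self _, disjoint_compl_right, fun u hu => ?_⟩
  funext y
  by_cases hy : y ∈ {y | ∀ u ∈ Feichtinger.segalAlgebra μ I, Φ u y = u (α y)}
  · rw [Pi.add_apply, Set.indicator_of_mem hy, Set.indicator_of_notMem (by simpa using hy),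
      add_zero, hy u hu]
    rfl
  · rw [Pi.add_apply, Set.indicator_of_notMem hy, Set.indicator_of_mem hy, zero_add,
      (hα y).resolve_left hy u hu]
    rfl
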